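/- **Notation.** Let $k$ be a perfect field. For a field $F$, let $K^{MW}_*(F)$ be the Milnor–Witt $K$-theory ring of $F$: the $\mathbb Z$-graded (associative, unital) ring generated by symbols $[a]$, $a\in F^\times$, in degree $1$ and $\eta$ in degree $-1$, subject to $[a][1-a]=0$ ($a\neq 0,1$), $[ab]=[a]+[b]+\eta[a][b]$, $\eta[a]=[a]\eta$ and $\eta(\eta[-1]+2)=0$; put $\langle a\rangle=1+\eta[a]\in K^{MW}_0(F)$. For a one-dimensional $F$-vector space $L$ with set of nonzero elements $L^0$ put $K^{MW}_n(F,L)=K^{MW}_n(F)\otimes_{\mathbb Z[F^\times]}\mathbb Z[L^0]$, where $u\in F^\times$ acts on $K^{MW}_n(F)$ as multiplication by $\langle u\rangle$ and on $L^0$ by scaling. For a finite-dimensional vector space $V$ put $D(V)=(\det V,\dim V)$, a graded line, and write $K^{MW}_n(F,D(V))=K^{MW}_n(F,\det V)$; the integer $\dim V$ only affects signs in isomorphisms of graded lines. Let $F$ be a finitely generated field extension of $k$. For a monic irreducible $p\in F[t]$ let $F(p)=F[t]/(p)$, let $\mathfrak m_p$ be the maximal ideal of the local ring $F[t]_{(p)}$,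 let $\bar p^{*}\in(\mathfrak m_p/\mathfrak m_p^2)^{*}$ be the element dual to the class $\bar p$ of $p$, and let $\partial_p^p:K^{MW}_n(F(t))\to K^{MW}_{n-1}(F(p))$ be the residue homomorphism: the unique homomorphism of graded groups of degree $-1$ that commutes with $\eta$ and satisfies $\partial_p^p([p][u_1]\cdots[u_m])=[\bar u_1]\cdots[\bar u_m]$ and $\partial_p^p([u_1]\cdots[u_m])=0$ for units $u_i$ of $F[t]_{(p)}$. The twisted residue $$\partial_p: K^{MW}_n(F(t),D(\Omega_{F(t)/k}))\to K^{MW}_{n-1}\bigl(F(p),(\mathfrak m_p/\mathfrak m_p^2)^{*}\otimes \det (F(p)\otimes_{F[t]}\Omega_{F[t]/k})\bigr)\cong K^{MW}_{n-1}(F(p),D(\Omega_{F(p)/k}))$$ sends $\alpha\otimes m$ to $\partial^p_p(\alpha)\otimes(\bar p^{*}\otimes \bar m)$ for every generator $m$ of the free rank-one $F[t]$-module $\det\Omega_{F[t]/k}$, where $\bar m$ is the image of $m$; this determines it. The isomorphism on the right is induced by the isomorphism $\det\Omega_{F(p)/k}\cong(\mathfrak m_p/\mathfrak m_p^2)^{*}\otimes\det(F(p)\otimes\Omega_{F[t]/k})$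 attached to the exact sequence $$0\to\mathfrak m_p/\mathfrak m_p^2\xrightarrow{\ x\mapsto 1\otimes dx\ }F(p)\otimes_{F[t]}\Omega_{F[t]/k}\to\Omega_{F(p)/k}\to0,$$ namely $\omega\mapsto-\bar p^{*}\otimes(dp\wedge\tilde\omega)$ with $\tilde\omega$ any lift of $\omega$ (the sign comes from the sign rule for graded lines, by which the contraction $((\mathfrak m_p/\mathfrak m_p^2)^{*},-1)\otimes(\mathfrak m_p/\mathfrak m_p^2,1)\cong (F(p),0)$ is minus the evaluation). **Statement.** For every $x\in K^{MW}_n(F(t),D(\Omega_{F(t)/k}))$ one has $\partial_p(x)=0$ for all but finitely many $p$. Let $d=(\partial_p)_p$, with $p$ running through the monic irreducible polynomials in $F[t]$, and let $i$ be the homomorphism $\alpha\otimes l\mapsto\alpha_{F(t)}\otimes(l\wedge dt)$. Then for every $n\in\mathbb Z$ the sequence of abelian groups $$0\to K^{MW}_n(F,D(\Omega_{F/k}))\xrightarrow{\ i\ }K^{MW}_n(F(t),D(\Omega_{F(t)/k}))\xrightarrow{\ d\ }\bigoplus_pK^{MW}_{n-1}(F(p),D(\Omega_{F(p)/k}))\to0$$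 is split exact: it is exact, and there are homomorphisms $r$ and $s$ with $ri=\mathrm{id}$, $ds=\mathrm{id}$ and $ir+sd=\mathrm{id}$. -/

import Mathlib

set_option linter.unusedSectionVars false

namespace MW

/-- Generators of Milnor-Witt K-theory: the symbols `[a]`, for `a` a unit of `F`, and `η`. -/
inductive Gen (F : Type*) [Field F]
  | sym (a : Fˣ) : Gen F
  | eta : Gen F

/-- `[a]` has degree `1` and `η` has degree `-1`. -/
def Gen.deg {F : Type*} [Field F] : Gen F → ℤ
  | .sym _ => 1
  | .eta => -1

section
open FreeAlgebra (ι)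

/-- The defining relations: `[a][1 - a] = 0`, `[ab] = [a] + [b] + η[a][b]`, `η[a] = [a]η` and
`η(η[-1] + 2) = 0`. -/
inductive Rel (F : Type*) [Field F] : FreeAlgebra ℤ (Gen F) → FreeAlgebra ℤ (Gen F) → Prop
  | steinberg (a b : Fˣ) (h : (a : F) + b = 1) :
      Rel F (ι ℤ (Gen.sym a) * ι ℤ (Gen.sym b)) 0
  | mul (a b : Fˣ) :
      Rel F (ι ℤ (Gen.sym (a * b)))
        (ι ℤ (Gen.sym a) + ι ℤ (Gen.sym b)
          + ι ℤ Gen.eta * ι ℤ (Gen.sym a) * ι ℤ (Gen.sym b))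
  | comm (a : Fˣ) :
      Rel F (ι ℤ Gen.eta * ι ℤ (Gen.sym a)) (ι ℤ (Gen.sym a) * ι ℤ Gen.eta)
  | hyperbolic :
      Rel F (ι ℤ Gen.eta * (ι ℤ Gen.eta * ι ℤ (Gen.sym (-1)) + 2)) 0
end

/-- The Milnor-Witt K-theory ring of `F`: the free ring on the symbols `[a]` and `η` modulo the
relations above.  Its homogeneous parts are the groups `KMW.deg F n` below. -/
def KMW (F : Type*) [Field F] : Type _ := RingQuot (Rel F)

noncomputable instance (F : Type*) [Field F] : Ring (KMW F) :=
  inferInstanceAs (Ring (RingQuot (Rel F)))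

namespace KMW

section basics
variable {F : Type*} [Field F]

/-- The projection from the free ring. -/
noncomputable def mk (F : Type*) [Field F] : FreeAlgebra ℤ (Gen F) →+* KMW F :=
  RingQuot.mkRingHom (Rel F)

theorem mk_rel {x y : FreeAlgebra ℤ (Gen F)} (h : Rel F x y) : mk F x = mk F y :=
  RingQuot.mkRingHom_rel h

/-- The class of a generator. -/
noncomputable def gen (g : Gen F) : KMW F := mk F (FreeAlgebra.ι ℤ g)

/-- The symbol `[a]`. -/
noncomputable def sym (a : Fˣ) : KMW F := gen (Gen.sym a)

/-- The element `η`. -/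
noncomputable def eta : KMW F := gen Gen.eta

theorem steinberg {a b : Fˣ} (h : (a : F) + b = 1) : sym a * sym b = 0 := by
  simpa [sym, gen] using mk_rel (Rel.steinberg a b h)

theorem sym_mul (a b : Fˣ) : sym (a * b) = sym a + sym b + eta * sym a * sym b := by
  simpa [sym, eta, gen] using mk_rel (Rel.mul a b)

theorem eta_sym (a : Fˣ) : (eta : KMW F) * sym a = sym a * eta := by
  simpa [sym, eta, gen] using mk_rel (Rel.comm a)

theorem eta_hyp : (eta : KMW F) * (eta * sym (-1) + 2) = 0 := by
  simpa [sym, eta, gen, map_ofNat] using mk_rel (Rel.hyperbolic (F := F))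

/-- The universal property of Milnor-Witt K-theory. -/
noncomputable def lift {R : Type*} [Ring R] (s : Fˣ → R) (e : R)
    (h1 : ∀ a b : Fˣ, (a : F) + b = 1 → s a * s b = 0)
    (h2 : ∀ a b : Fˣ, s (a * b) = s a + s b + e * s a * s b)
    (h3 : ∀ a : Fˣ, e * s a = s a * e)
    (h4 : e * (e * s (-1) + 2) = 0) : KMW F →+* R :=
  RingQuot.lift ⟨(FreeAlgebra.lift ℤ (fun g : Gen F => match g with
      | .sym a => s a
      | .eta => e)).toRingHom, by
    intro x y h
    cases h with
    | steinberg a b h => simpa using h1 a b h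
    | mul a b => simpa using h2 a b
    | comm a => simpa using h3 a
    | hyperbolic => simpa [map_ofNat] using h4⟩

section lift
variable {R : Type*} [Ring R] {s : Fˣ → R} {e : R}
    {h1 : ∀ a b : Fˣ, (a : F) + b = 1 → s a * s b = 0}
    {h2 : ∀ a b : Fˣ, s (a * b) = s a + s b + e * s a * s b}
    {h3 : ∀ a : Fˣ, e * s a = s a * e}
    {h4 : e * (e * s (-1) + 2) = 0}

theorem lift_sym (a : Fˣ) : lift s e h1 h2 h3 h4 (sym a) = s a := by
  exact (RingQuot.lift_mkRingHom_apply _ _ _).trans (by simp)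

theorem lift_eta : lift s e h1 h2 h3 h4 eta = e := by
  exact (RingQuot.lift_mkRingHom_apply _ _ _).trans (by simp)
end lift

theorem induction {P : KMW F → Prop} (x : KMW F) (hz : ∀ n : ℤ, P n) (hs : ∀ a, P (sym a))
    (he : P eta) (hadd : ∀ x y, P x → P y → P (x + y)) (hmul : ∀ x y, P x → P y → P (x * y)) :
    P x := by
  obtain ⟨x, rfl⟩ : ∃ y, mk F y = x := RingQuot.mkRingHom_surjective (Rel F) x
  induction x using FreeAlgebra.induction with
  | grade0 r => simpa using hz r
  | grade1 g =>
    cases g with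
    | sym a => exact hs a
    | eta => exact he
  | mul x y hx hy => rw [map_mul]; exact hmul _ _ hx hy
  | add x y hx hy => rw [map_add]; exact hadd _ _ hx hy

theorem commute_of_sym {z : KMW F} (h1 : ∀ a, Commute z (sym a)) (h2 : Commute z eta)
    (x : KMW F) : Commute z x := by
  induction x using KMW.induction with
  | hz n => exact Int.commute_cast z n
  | hs a => exact h1 a
  | he => exact h2
  | hadd x y hx hy => exact hx.add_right hy
  | hmul x y hx hy => exact hx.mul_right hy

theorem eta_comm (x : KMW F) : Commute eta x :=
  commute_of_sym (fun a => eta_sym a) (Commute.refl _) x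

/-- `⟨a⟩ = 1 + η[a]`. -/
noncomputable def form (a : Fˣ) : KMW F := 1 + eta * sym a

theorem eta_sym_eq (a : Fˣ) : (eta : KMW F) * sym a = form a - 1 := by simp [form]

theorem sym_mul' (a b : Fˣ) : sym (a * b) = sym a + form a * sym b := by
  rw [sym_mul, form]; noncomm_ring

theorem form_comm (a : Fˣ) (x : KMW F) : Commute (form a) x := by
  have key : ∀ b : Fˣ, (eta : KMW F) * sym a * sym b = sym b * (eta * sym a) := by
    intro b
    have h := sym_mul a b
    rw [mul_comm a b, sym_mul b a] at h
    have h' : (eta : KMW F) * sym b * sym a = eta * sym a * sym b := by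
      have := congrArg (fun z => z - sym a - sym b) h
      calc _ = sym b + sym a + eta * sym b * sym a - sym a - sym b := by abel
        _ = _ := this
        _ = _ := by abel
    rw [← h', eta_sym, mul_assoc]
  refine (Commute.one_left x).add_left (commute_of_sym (fun b => key b) ?_ x)
  exact (eta_comm _).symm

theorem sym_one : sym (1 : Fˣ) = 0 := by
  have e1 : (eta : KMW F) * eta * sym (-1) = - 2 * eta := by
    have := eta_hyp (F := F)
    rw [mul_add, ← mul_assoc] at this
    rw [eq_neg_of_add_eq_zero_left this]
    noncomm_ring
  have e2 : sym (1 : Fˣ) = 2 * sym (-1) + eta * sym (-1) * sym (-1) := by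
    have := sym_mul (-1 : Fˣ) (-1)
    rw [neg_mul_neg, one_mul] at this
    rw [this, two_mul]
  have e3 : (eta : KMW F) * sym 1 = 0 := by
    calc (eta : KMW F) * sym 1 = 2 * (eta * sym (-1)) + (eta * eta * sym (-1)) * sym (-1) := by
          rw [e2]; noncomm_ring
      _ = 0 := by rw [e1]; noncomm_ring
  have e4 := sym_mul' (1 : Fˣ) 1
  rw [mul_one, form, e3, add_zero, one_mul] at e4
  exact left_eq_add.mp e4

theorem form_one : form (1 : Fˣ) = 1 := by simp [form, sym_one]

theorem form_mul (a b : Fˣ) : form (a * b) = form a * form b := by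
  simp only [form, sym_mul]
  have : (eta : KMW F) * sym a * (eta * sym b) = eta * (eta * sym a * sym b) := by
    rw [mul_assoc, ← mul_assoc (sym a), ← eta_sym]
  rw [add_mul, mul_add, mul_add, mul_add, mul_add, this]
  noncomm_ring

/-- `a ↦ ⟨a⟩` as a homomorphism from the units of `F`. -/
noncomputable def formHom (F : Type*) [Field F] : Fˣ →* KMW F where
  toFun := form
  map_one' := form_one
  map_mul' := form_mul

theorem form_neg_one_mul_sym : form (-1 : Fˣ) * sym (-1) = - sym (-1) := by
  have := sym_mul' (-1 : Fˣ) (-1)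
  rw [neg_mul_neg, one_mul, sym_one] at this
  exact (eq_neg_of_add_eq_zero_right this.symm)

theorem form_neg_one_sq : form (-1 : Fˣ) * form (-1) = 1 := by
  rw [← form_mul, neg_mul_neg, one_mul, form_one]

theorem eta_form_neg_one : (eta : KMW F) * form (-1) = - eta := by
  have h := eta_hyp (F := F)
  have : (eta : KMW F) * (eta * sym (-1) + 2) = eta * form (-1) + eta := by
    rw [form]; noncomm_ring
  rw [this] at h
  exact eq_neg_of_add_eq_zero_left h

theorem sym_inv (a : Fˣ) : sym a = - (form a * sym a⁻¹) := by
  have := sym_mul' a a⁻¹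
  rw [mul_inv_cancel, sym_one] at this
  exact (eq_neg_of_add_eq_zero_left this.symm)

theorem sym_neg_self (a : Fˣ) : sym a * sym (-a) = 0 := by
  by_cases ha : a = 1
  · rw [ha, sym_one, zero_mul]
  have ha1 : (1 : F) - a ≠ 0 := fun h => ha (Units.ext (by simpa using (sub_eq_zero.mp h).symm))
  have ha2 : (1 : F) - (a : F)⁻¹ ≠ 0 := fun h => ha (Units.ext (by
    have := (sub_eq_zero.mp h); simpa [eq_comm] using this))
  have e : -a * Units.mk0 _ ha2 = Units.mk0 _ ha1 := by
    ext; simp only [Units.val_mul, Units.val_neg, Units.val_mk0]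
    field_simp; ring
  have h1 : sym (-a) = sym (Units.mk0 _ ha1) - form (-a) * sym (Units.mk0 _ ha2) := by
    rw [← e, sym_mul']; abel
  have h2 : sym a * sym (Units.mk0 _ ha1) = 0 := steinberg (by simp)
  have h3 : sym a⁻¹ * sym (Units.mk0 _ ha2) = 0 := steinberg (by simp)
  rw [h1, mul_sub, h2, zero_sub, ← mul_assoc, ← (form_comm _ _).eq, sym_inv a, mul_neg, neg_mul,
    mul_assoc, mul_assoc, h3]
  simp

/-- `n_ε`, the alternating sum `⟨1⟩ + ⟨-1⟩ + ⟨1⟩ + ⋯` of `n` terms for `n ≥ 0`, extended to all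
integers. -/
noncomputable def epsInt (F : Type*) [Field F] (n : ℤ) : KMW F :=
  ((n / 2 : ℤ) : KMW F) * (1 + form (-1)) + ((n % 2 : ℤ) : KMW F)

theorem epsInt_comm (n : ℤ) (x : KMW F) : Commute (epsInt F n) x :=
  (((Int.cast_commute _ _).mul_left ((Commute.one_left x).add_left (form_comm _ _)))).add_left
    (Int.cast_commute _ _)

theorem epsInt_even (n : ℤ) : epsInt F (2 * n) = (n : KMW F) * (1 + form (-1)) := by
  simp [epsInt]

theorem epsInt_odd (n : ℤ) : epsInt F (2 * n + 1) = (n : KMW F) * (1 + form (-1)) + 1 := by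
  have h1 : (2 * n + 1) / 2 = n := by omega
  have h2 : (2 * n + 1) % 2 = 1 := by omega
  simp [epsInt, h1, h2]

theorem epsInt_zero : epsInt F 0 = 0 := by simp [epsInt]

theorem epsInt_one : epsInt F 1 = 1 := by simp [epsInt]

theorem neg_one_zpow_even (n : ℤ) : (-1 : Fˣ) ^ (2 * n) = 1 := by
  rw [zpow_mul]; simp

theorem neg_one_zpow_odd (n : ℤ) : (-1 : Fˣ) ^ (2 * n + 1) = -1 := by
  rw [zpow_add, neg_one_zpow_even]; simp

theorem form_mul_hyp : form (-1 : Fˣ) * (1 + form (-1)) = 1 + form (-1) := by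
  rw [mul_add, form_neg_one_sq, mul_one, add_comm]

theorem epsInt_add (n m : ℤ) :
    epsInt F (n + m) = epsInt F m + form ((-1 : Fˣ) ^ m) * epsInt F n := by
  have hc : ∀ k : ℤ, form (-1 : Fˣ) * ((k : KMW F) * (1 + form (-1)))
      = (k : KMW F) * (1 + form (-1)) := fun k => by
    rw [← mul_assoc, (Int.commute_cast _ k).eq, mul_assoc, form_mul_hyp]
  rcases Int.even_or_odd' n with ⟨a, rfl | rfl⟩ <;> rcases Int.even_or_odd' m with ⟨b, rfl | rfl⟩
  · rw [← mul_add, epsInt_even, epsInt_even, epsInt_even, neg_one_zpow_even, form_one]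
    push_cast; noncomm_ring
  · rw [show 2 * a + (2 * b + 1) = 2 * (a + b) + 1 by ring, epsInt_odd, epsInt_even, epsInt_odd,
      neg_one_zpow_odd, hc]
    push_cast; noncomm_ring
  · rw [show 2 * a + 1 + 2 * b = 2 * (a + b) + 1 by ring, epsInt_odd, epsInt_even, epsInt_odd,
      neg_one_zpow_even, form_one]
    push_cast; noncomm_ring
  · rw [show 2 * a + 1 + (2 * b + 1) = 2 * (a + b + 1) by ring, epsInt_odd, epsInt_even, epsInt_odd,
      neg_one_zpow_odd, mul_add (form _), hc, mul_one]
    push_cast; noncomm_ring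

theorem hyp_mul_sym_neg_one : (1 + form (-1 : Fˣ)) * sym (-1) = 0 := by
  rw [add_mul, form_neg_one_mul_sym, one_mul, add_neg_cancel]

theorem epsInt_mul_sub (n : ℤ) (u : Fˣ) :
    epsInt F n * (sym u - sym ((-1 : Fˣ) ^ (n + 1) * u)) = 0 := by
  rcases Int.even_or_odd' n with ⟨a, rfl | rfl⟩
  · rw [neg_one_zpow_odd, epsInt_even, mul_comm (-1 : Fˣ) u, sym_mul', sub_add_cancel_left,
      mul_neg, (form_comm u _).eq, mul_assoc, ← mul_assoc _ (sym (-1)), hyp_mul_sym_neg_one]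
    simp
  · rw [show 2 * a + 1 + 1 = 2 * (a + 1) by ring, neg_one_zpow_even, one_mul, sub_self, mul_zero]

/-- `ε = -⟨-1⟩`. -/
noncomputable def eps (F : Type*) [Field F] : KMW F := - form (-1)

theorem eps_comm (x : KMW F) : Commute (eps F) x := (form_comm _ _).neg_left

theorem eps_sq : eps F * eps F = 1 := by simp [eps, form_neg_one_sq]

theorem eta_eps : (eta : KMW F) * eps F = eta := by simp [eps, eta_form_neg_one]

theorem eta_mul_eps_mul (x : KMW F) : (eta : KMW F) * (eps F * x) = eta * x := by
  rw [← mul_assoc, eta_eps]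

end basics

section residue

/-- A prime element `unif` of a domain `A` in which powers of primes dividing a given nonzero
element are bounded, together with its residue field `κ = A / (unif)`, assumed to be a field.
This gives a discrete valuation on the fraction field `K` of `A` with uniformizer `unif` and
residue field `κ`. -/
structure ResidueDatum (A K κ : Type*) [CommRing A] [IsDomain A] [WfDvdMonoid A] [Field K]
    [Algebra A K] [IsFractionRing A K] [Field κ] where
  unif : A
  prime : Prime unif
  red : A →+* κ
  red_surjective : Function.Surjective red
  red_eq_zero_iff : ∀ a, red a = 0 ↔ unif ∣ a

namespace ResidueDatum

variable {A K κ : Type*} [CommRing A] [IsDomain A] [WfDvdMonoid A] [Field K]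
    [Algebra A K] [IsFractionRing A K] [Field κ] (v : ResidueDatum A K κ)

/-- `a = unif ^ n * (x / y)` where `unif` divides neither `x` nor `y`. -/
def IsRep (a : Kˣ) (n : ℤ) (x y : A) : Prop :=
  ¬ v.unif ∣ x ∧ ¬ v.unif ∣ y ∧
    (a : K) * algebraMap A K y = algebraMap A K v.unif ^ n * algebraMap A K x

theorem unif_ne_zero : algebraMap A K v.unif ≠ 0 := fun h =>
  v.prime.ne_zero ((IsFractionRing.injective A K) (by rw [h, map_zero]))

theorem ne_zero_of_not_dvd {x : A} (h : ¬ v.unif ∣ x) : algebraMap A K x ≠ 0 := fun h' =>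
  h (by rw [(IsFractionRing.injective A K) (h'.trans (map_zero _).symm)]; exact dvd_zero _)

theorem exists_isRep (a : Kˣ) : ∃ t : ℤ × A × A, v.IsRep a t.1 t.2.1 t.2.2 := by
  obtain ⟨x, y, hy, e⟩ := IsFractionRing.div_surjective (A := A) (a : K)
  have hy0 : y ≠ 0 := nonZeroDivisors.ne_zero hy
  have hx0 : x ≠ 0 := by
    rintro rfl
    exact a.ne_zero (by rw [← e, map_zero, zero_div])
  obtain ⟨n, x', hx', rfl⟩ := WfDvdMonoid.max_power_factor hx0 v.prime.irreducible
  obtain ⟨m, y', hy', rfl⟩ := WfDvdMonoid.max_power_factor hy0 v.prime.irreducible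
  refine ⟨((n : ℤ) - m, x', y'), hx', hy', ?_⟩
  have h1 := v.ne_zero_of_not_dvd (K := K) hy'
  have h2 := v.unif_ne_zero (K := K)
  rw [← e, zpow_sub₀ h2]
  simp only [map_mul, map_pow, zpow_natCast]
  field_simp

theorem isRep_unique_aux {a : Kˣ} {n m : ℤ} {x y z w : A} (h1 : v.IsRep a n x y)
    (h2 : v.IsRep a m z w) : m ≤ n := by
  by_contra! hlt
  obtain ⟨d, rfl⟩ : ∃ d : ℕ, m = n + (d + 1 : ℕ) := ⟨(m - n - 1).toNat, by omega⟩
  have hpi := v.unif_ne_zero (K := K)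
  have e : algebraMap A K (x * w) = algebraMap A K (v.unif ^ (d + 1) * z * y) := by
    have e1 := h1.2.2
    have e2 := h2.2.2
    rw [zpow_add₀ hpi, zpow_natCast] at e2
    have := zpow_ne_zero n hpi
    apply mul_left_cancel₀ this
    simp only [map_mul, map_pow]
    linear_combination (-algebraMap A K w) * e1 + algebraMap A K y * e2
  have e' := IsFractionRing.injective A K e
  rcases v.prime.dvd_or_dvd (a := x) (b := w)
    (e' ▸ ⟨v.unif ^ d * z * y, by ring⟩) with h | h
  · exact h1.1 h
  · exact h2.2.1 h

/-- The valuation of `a`. -/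
noncomputable def ord (a : Kˣ) : ℤ := (v.exists_isRep a).choose.1

theorem red_ne_zero {x : A} (h : ¬ v.unif ∣ x) : v.red x ≠ 0 := fun h' =>
  h ((v.red_eq_zero_iff x).mp h')

/-- The class in the residue field of the unit `a / unif ^ ord a` of the valuation ring. -/
noncomputable def lead (a : Kˣ) : κˣ :=
  Units.mk0 (v.red (v.exists_isRep a).choose.2.1) (v.red_ne_zero (v.exists_isRep a).choose_spec.1) /
  Units.mk0 (v.red (v.exists_isRep a).choose.2.2) (v.red_ne_zero (v.exists_isRep a).choose_spec.2.1)

variable {v}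

theorem IsRep.ord_eq {a : Kˣ} {n : ℤ} {x y : A} (h : v.IsRep a n x y) : v.ord a = n :=
  le_antisymm (v.isRep_unique_aux h (v.exists_isRep a).choose_spec)
    (v.isRep_unique_aux (v.exists_isRep a).choose_spec h)

theorem IsRep.lead_eq {a : Kˣ} {n : ℤ} {x y : A} (h : v.IsRep a n x y) :
    (v.lead a : κ) = v.red x / v.red y := by
  have h' := (v.exists_isRep a).choose_spec
  have hn : (v.exists_isRep a).choose.1 = n := h.ord_eq
  simp only [lead, Units.val_div_eq_div_val, Units.val_mk0]
  generalize (v.exists_isRep a).choose = t at h' hn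
  obtain ⟨m, z, w⟩ := t
  simp only at hn h'
  subst hn
  have hpi := v.unif_ne_zero (K := K)
  rw [div_eq_div_iff (v.red_ne_zero h'.2.1) (v.red_ne_zero h.2.1), ← map_mul, ← map_mul]
  congr 1
  apply IsFractionRing.injective A K
  apply mul_left_cancel₀ (zpow_ne_zero m hpi)
  simp only [map_mul]
  linear_combination (- algebraMap A K y) * h'.2.2 + algebraMap A K w * h.2.2

variable (v)

theorem isRep_exists (a : Kˣ) : ∃ x y, v.IsRep a (v.ord a) x y :=
  ⟨_, _, (v.exists_isRep a).choose_spec⟩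

theorem ord_lead_mul (a b : Kˣ) : v.ord (a * b) = v.ord a + v.ord b ∧
    v.lead (a * b) = v.lead a * v.lead b := by
  obtain ⟨x, y, h⟩ := v.isRep_exists a
  obtain ⟨z, w, h'⟩ := v.isRep_exists b
  have : v.IsRep (a * b) (v.ord a + v.ord b) (x * z) (y * w) := by
    refine ⟨fun hd => ?_, fun hd => ?_, ?_⟩
    · exact (v.prime.dvd_or_dvd hd).elim h.1 h'.1
    · exact (v.prime.dvd_or_dvd hd).elim h.2.1 h'.2.1
    · rw [zpow_add₀ v.unif_ne_zero]
      simp only [map_mul, Units.val_mul]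
      linear_combination (b * algebraMap A K w) * h.2.2 +
        (algebraMap A K v.unif ^ v.ord a * algebraMap A K x) * h'.2.2
  refine ⟨this.ord_eq, Units.ext ?_⟩
  rw [this.lead_eq, Units.val_mul, h.lead_eq, h'.lead_eq, map_mul, map_mul, mul_div_mul_comm]

theorem ord_mul (a b : Kˣ) : v.ord (a * b) = v.ord a + v.ord b := (v.ord_lead_mul a b).1

theorem lead_mul (a b : Kˣ) : v.lead (a * b) = v.lead a * v.lead b := (v.ord_lead_mul a b).2

theorem isRep_of_not_dvd {x : A} (hx : ¬ v.unif ∣ x) (a : Kˣ) (ha : (a : K) = algebraMap A K x) :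
    v.IsRep a 0 x 1 :=
  ⟨hx, v.prime.not_dvd_one, by simp [ha]⟩

theorem ord_neg_one : v.ord (-1 : Kˣ) = 0 ∧ v.lead (-1 : Kˣ) = -1 := by
  have : v.IsRep (-1 : Kˣ) 0 (-1) 1 := v.isRep_of_not_dvd
    (fun h => v.prime.not_dvd_one (by simpa using h)) _ (by simp)
  exact ⟨this.ord_eq, Units.ext (by rw [this.lead_eq]; simp)⟩

theorem add_one_pos {a b : Kˣ} (h : (a : K) + b = 1) (ha : 0 < v.ord a) :
    v.ord b = 0 ∧ v.lead b = 1 := by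
  obtain ⟨x, y, hr⟩ := v.isRep_exists a
  obtain ⟨d, hd⟩ : ∃ d : ℕ, v.ord a = (d + 1 : ℕ) := ⟨(v.ord a - 1).toNat, by omega⟩
  rw [hd] at hr
  have e := hr.2.2
  rw [zpow_natCast] at e
  have : v.IsRep b 0 (y - v.unif ^ (d + 1) * x) y := by
    refine ⟨fun hdv => hr.2.1 ?_, hr.2.1, ?_⟩
    · exact (dvd_sub_left (Dvd.intro (v.unif ^ d * x) (by ring))).mp hdv
    · simp only [map_sub, map_mul, map_pow, zpow_zero, one_mul]
      linear_combination algebraMap A K y * h - e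
  refine ⟨this.ord_eq, Units.ext ?_⟩
  rw [this.lead_eq, map_sub, map_mul, map_pow, (v.red_eq_zero_iff v.unif).mpr dvd_rfl]
  simp [v.red_ne_zero hr.2.1]

theorem add_one_neg {a b : Kˣ} (h : (a : K) + b = 1) (ha : v.ord a < 0) :
    v.ord b = v.ord a ∧ v.lead b = - v.lead a := by
  obtain ⟨x, y, hr⟩ := v.isRep_exists a
  obtain ⟨d, hd⟩ : ∃ d : ℕ, v.ord a = - (d + 1 : ℕ) := ⟨(- v.ord a - 1).toNat, by omega⟩
  rw [hd] at hr
  have e := hr.2.2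
  have hpi := v.unif_ne_zero (K := K)
  have hpd := pow_ne_zero (d + 1) hpi
  rw [zpow_neg, zpow_natCast] at e
  have : v.IsRep b (- (d + 1 : ℕ)) (v.unif ^ (d + 1) * y - x) y := by
    refine ⟨fun hdv => hr.1 ?_, hr.2.1, ?_⟩
    · exact (dvd_sub_right (Dvd.intro (v.unif ^ d * y) (by ring))).mp hdv
    · simp only [map_sub, map_mul, map_pow, zpow_neg, zpow_natCast]
      rw [mul_sub, inv_mul_cancel_left₀ hpd]
      linear_combination algebraMap A K y * h - e
  refine ⟨this.ord_eq.trans hd.symm, Units.ext ?_⟩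
  rw [this.lead_eq, map_sub, map_mul, map_pow, (v.red_eq_zero_iff v.unif).mpr dvd_rfl,
    Units.val_neg, hr.lead_eq]
  simp [neg_div]

theorem add_one_zero {a b : Kˣ} (h : (a : K) + b = 1) (ha : v.ord a = 0) (hb : v.ord b = 0) :
    (v.lead a : κ) + v.lead b = 1 := by
  obtain ⟨x, y, hr⟩ := v.isRep_exists a
  obtain ⟨z, w, hr'⟩ := v.isRep_exists b
  rw [hr.lead_eq, hr'.lead_eq, div_add_div _ _ (v.red_ne_zero hr.2.1) (v.red_ne_zero hr'.2.1),
    div_eq_one_iff_eq (mul_ne_zero (v.red_ne_zero hr.2.1) (v.red_ne_zero hr'.2.1))]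
  simp only [← map_mul, ← map_add]
  congr 1
  apply IsFractionRing.injective A K
  have e := hr.2.2
  have e' := hr'.2.2
  rw [ha, zpow_zero, one_mul] at e
  rw [hb, zpow_zero, one_mul] at e'
  simp only [map_add, map_mul]
  linear_combination (algebraMap A K y * algebraMap A K w) * h - algebraMap A K w * e
    - algebraMap A K y * e'

end ResidueDatum

open Matrix

section

variable {κ : Type*} [Field κ]

/-- The matrix attached below to the symbol `[π ^ n u]`. -/
noncomputable def symMatrix (n : ℤ) (u : κˣ) : Matrix (Fin 2) (Fin 2) (KMW κ) :=
  !![sym u, 0; epsInt κ n * form u, eps κ * sym ((-1) ^ n * u)]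

/-- The matrix attached below to `η`. -/
noncomputable def etaMatrix (κ : Type*) [Field κ] : Matrix (Fin 2) (Fin 2) (KMW κ) :=
  !![eta, 0; 0, eta]

theorem symMatrix_mul (n m : ℤ) (u w : κˣ) :
    symMatrix (n + m) (u * w) = symMatrix n u + symMatrix m w
      + etaMatrix κ * symMatrix n u * symMatrix m w := by
  have hw : (-1 : κˣ) ^ (n + m) * (u * w) = ((-1) ^ n * u) * ((-1) ^ m * w) := by
    rw [_root_.zpow_add]; exact mul_mul_mul_comm _ _ _ _
  have h00 : sym (u * w) = sym u + sym w + eta * sym u * sym w := sym_mul u w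
  have h11 : ∀ x y : κˣ, eps κ * sym (x * y) = eps κ * sym x + eps κ * sym y
      + eta * (eps κ * sym x) * (eps κ * sym y) := fun x y => by
    have e : eta * sym x * (eps κ * sym y) = eps κ * (eta * sym x * sym y) := by
      rw [← mul_assoc, ← (eps_comm (eta * sym x)).eq, mul_assoc]
    rw [sym_mul, eta_mul_eps_mul, mul_add, mul_add, e]
  have h10 : epsInt κ (n + m) * form (u * w) = epsInt κ n * form u + epsInt κ m * form w
      + (eta * (epsInt κ n * form u) * sym w
        + eta * (eps κ * sym ((-1) ^ n * u)) * (epsInt κ m * form w)) := by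
    have e1 : eta * (epsInt κ n * form u) * sym w
        = epsInt κ n * (form u * form w) - epsInt κ n * form u := by
      rw [(eta_comm (epsInt κ n * form u)).eq, mul_assoc, eta_sym_eq, mul_sub, mul_one, mul_assoc]
    have e2 : eta * (eps κ * sym ((-1) ^ n * u)) * (epsInt κ m * form w)
        = form ((-1) ^ n) * epsInt κ m * (form u * form w) - epsInt κ m * form w := by
      rw [eta_mul_eps_mul, eta_sym_eq, form_mul, sub_mul, one_mul, mul_assoc,
        ← mul_assoc (form u), (form_comm u (epsInt κ m)).eq]
      simp only [mul_assoc]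
    rw [e1, e2, add_comm n m, epsInt_add, form_mul]
    noncomm_ring
  simp only [symMatrix, etaMatrix, Matrix.mul_fin_two, mul_zero, zero_mul, add_zero, zero_add, hw]
  ext i j
  fin_cases i <;> fin_cases j
  · simpa using h00
  · simp
  · simpa using h10
  · simpa using h11 _ _

theorem symMatrix_zero (u : κˣ) : symMatrix 0 u = !![sym u, 0; 0, eps κ * sym u] := by
  simp [symMatrix, epsInt_zero]

theorem symMatrix_zero_one : symMatrix 0 (1 : κˣ) = 0 := by
  rw [symMatrix_zero, sym_one]
  ext i j; fin_cases i <;> fin_cases j <;> simp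

theorem symMatrix_mul_neg (n : ℤ) (u : κˣ) : symMatrix n u * symMatrix n (-u) = 0 := by
  have h11 : ∀ x : κˣ, eps κ * sym x * (eps κ * sym (-x)) = 0 := fun x => by
    rw [mul_assoc, ← mul_assoc (sym x), ← (eps_comm (sym x)).eq, mul_assoc, sym_neg_self]
    simp
  have h10 : epsInt κ n * form u * sym (-u) + eps κ * sym ((-1) ^ n * u) * (epsInt κ n * form (-u))
      = 0 := by
    have e : (-1 : κˣ) ^ n * u = (-1) ^ (n + 1) * -u := by
      rw [_root_.zpow_add, zpow_one]; simp
    have e2 : eps κ * form (-u) = - form u := by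
      rw [eps, neg_mul, ← form_mul]; simp
    have e3 : ∀ x : KMW κ, eps κ * x * (epsInt κ n * form (-u)) = - (epsInt κ n * form u * x) :=
      fun x => by
        rw [mul_assoc, ← mul_assoc x, ← (epsInt_comm n x).eq, mul_assoc,
          ← (form_comm (-u) x).eq, ← mul_assoc, (eps_comm (epsInt κ n)).eq, mul_assoc,
          ← mul_assoc (eps κ), e2]
        noncomm_ring
    rw [e, e3, ← sub_eq_add_neg, ← mul_sub, (epsInt_comm n (form u)).eq, mul_assoc,
      epsInt_mul_sub, mul_zero]
  simp only [symMatrix, Matrix.mul_fin_two, mul_zero, zero_mul, add_zero, zero_add, mul_neg]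
  ext i j
  fin_cases i <;> fin_cases j
  · simpa using sym_neg_self u
  · simp
  · simpa using h10
  · simpa using h11 ((-1) ^ n * u)

end

variable {A K κ : Type*} [CommRing A] [IsDomain A] [WfDvdMonoid A] [Field K]
    [Algebra A K] [IsFractionRing A K] [Field κ] (v : ResidueDatum A K κ)

/-- The ring homomorphism from the Milnor-Witt K-theory of `K` to lower triangular matrices over
that of `κ` whose entry below the diagonal is the residue; the diagonal entries are the
specialization `α ↦ s(α)` with `s([π ^ n u]) = [u]` and a version of it twisted by signs. -/
noncomputable def residueMatrix : KMW K →+* Matrix (Fin 2) (Fin 2) (KMW κ) :=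
  lift (fun a => symMatrix (v.ord a) (v.lead a)) (etaMatrix κ)
    (by
      intro a b h
      have h' : (b : K) + a = 1 := by rw [add_comm]; exact h
      rcases lt_trichotomy (v.ord a) 0 with ha | ha | ha
      · obtain ⟨e1, e2⟩ := v.add_one_neg h ha
        rw [e1, e2, symMatrix_mul_neg]
      · rcases lt_trichotomy (v.ord b) 0 with hb | hb | hb
        · exact absurd (v.add_one_neg h' hb).1 (by omega)
        · rw [ha, hb, symMatrix_zero, symMatrix_zero, Matrix.mul_fin_two]
          have h1 : sym (v.lead a) * sym (v.lead b) = 0 := steinberg (v.add_one_zero h ha hb)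
          have h2 : eps κ * sym (v.lead a) * (eps κ * sym (v.lead b)) = 0 := by
            rw [mul_assoc, ← mul_assoc (sym _), ← (eps_comm (sym _)).eq, mul_assoc, h1]
            simp
          rw [h1, h2]
          ext i j; fin_cases i <;> fin_cases j <;> simp
        · obtain ⟨e1, e2⟩ := v.add_one_pos h' hb
          rw [e1, e2, symMatrix_zero_one, zero_mul]
      · obtain ⟨e1, e2⟩ := v.add_one_pos h ha
        rw [e1, e2, symMatrix_zero_one, mul_zero])
    (by intro a b; rw [v.ord_mul, v.lead_mul, symMatrix_mul])
    (by
      intro a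
      simp only [symMatrix, etaMatrix, Matrix.mul_fin_two, mul_zero, zero_mul, add_zero, zero_add]
      rw [(eta_comm (sym _)).eq, (eta_comm (_ * form _)).eq, (eta_comm (eps κ * _)).eq])
    (by
      rw [v.ord_neg_one.1, v.ord_neg_one.2, symMatrix_zero, etaMatrix, Matrix.mul_fin_two]
      have := eta_hyp (F := κ)
      ext i j
      fin_cases i <;> fin_cases j <;>
        simp [Matrix.mul_apply, Fin.sum_univ_two, eta_mul_eps_mul, this, Matrix.ofNat_apply])

/-- The residue homomorphism with respect to the uniformizer `π = unif`.  It is the unique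
additive map that commutes with `η` (`residue_eta_mul`), lowers degrees by one (`residue_mem`),
and satisfies, for units `u₁, …, uₙ` of the valuation ring, `∂([π, u₁, …, uₙ]) = [ū₁, …, ūₙ]`
(`residue_unif_units`) and `∂([u₁, …, uₙ]) = 0` (`residue_units`). -/
noncomputable def residue : KMW K →+ KMW κ where
  toFun α := residueMatrix v α 1 0
  map_zero' := by simp
  map_add' := by simp

theorem residueMatrix_sym (a : Kˣ) :
    residueMatrix v (sym a) = symMatrix (v.ord a) (v.lead a) := lift_sym a

theorem residueMatrix_eta : residueMatrix v eta = etaMatrix κ := lift_eta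

theorem residueMatrix_upper (α : KMW K) : residueMatrix v α 0 1 = 0 := by
  induction α using KMW.induction with
  | hz n =>
    rw [map_intCast, ← zsmul_one]
    simp
  | hs a => simp [residueMatrix_sym, symMatrix]
  | he => simp [residueMatrix_eta, etaMatrix]
  | hadd x y hx hy => simp [hx, hy]
  | hmul x y hx hy => simp [Matrix.mul_apply, Fin.sum_univ_two, hx, hy]

theorem residue_mul (α β : KMW K) :
    residue v (α * β) = residue v α * residueMatrix v β 0 0 + residueMatrix v α 1 1 * residue v β := by
  simp [residue, Matrix.mul_apply, Fin.sum_univ_two]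

theorem residue_eta_mul (α : KMW K) : residue v (eta * α) = eta * residue v α := by
  rw [residue_mul]
  simp [residue, residueMatrix_eta, etaMatrix]

theorem residue_units_aux (l : List Kˣ) (hl : ∀ a ∈ l, v.ord a = 0) :
    residueMatrix v ((l.map sym).prod) 0 0 = (l.map (fun a => sym (v.lead a))).prod ∧
    residue v ((l.map sym).prod) = 0 := by
  induction l with
  | nil => simp [residue]
  | cons a l ih =>
    obtain ⟨h1, h2⟩ := ih (fun b hb => hl b (List.mem_cons_of_mem _ hb))
    have h3 : residue v (sym a) = 0 := by
      simp [residue, residueMatrix_sym, hl a (List.mem_cons_self), symMatrix_zero]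
    refine ⟨?_, ?_⟩
    · simp [Matrix.mul_apply, Fin.sum_univ_two, h1, residueMatrix_sym, symMatrix]
    · rw [List.map_cons, List.prod_cons, residue_mul, h2, h3]
      simp

theorem residue_units (l : List Kˣ) (hl : ∀ a ∈ l, v.ord a = 0) :
    residue v ((l.map sym).prod) = 0 := (residue_units_aux v l hl).2

theorem residue_unif_units (t : Kˣ) (ht : (t : K) = algebraMap A K v.unif) (l : List Kˣ)
    (hl : ∀ a ∈ l, v.ord a = 0) :
    residue v (sym t * (l.map sym).prod) = (l.map (fun a => sym (v.lead a))).prod := by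
  have hrep : v.IsRep t 1 1 1 := ⟨v.prime.not_dvd_one, v.prime.not_dvd_one, by simp [ht]⟩
  have hl' : v.lead t = 1 := Units.ext (by rw [hrep.lead_eq]; simp)
  rw [residue_mul, residue_units v l hl, (residue_units_aux v l hl).1]
  simp [residue, residueMatrix_sym, symMatrix, hrep.ord_eq, hl', epsInt_one, form_one]

end residue

section graded

variable (F : Type*) [Field F]

/-- Products of generators of total degree `n`. -/
def degSet (n : ℤ) : Set (KMW F) :=
  {x | ∃ l : List (Gen F), (l.map Gen.deg).sum = n ∧ (l.map gen).prod = x}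

/-- The homogeneous part of degree `n`, as a subgroup. -/
noncomputable def degGroup (n : ℤ) : AddSubgroup (KMW F) := AddSubgroup.closure (degSet F n)

variable {F}

theorem one_mem : (1 : KMW F) ∈ degGroup F 0 :=
  AddSubgroup.subset_closure ⟨[], by simp, by simp⟩

theorem sym_mem (a : Fˣ) : sym a ∈ degGroup F 1 :=
  AddSubgroup.subset_closure ⟨[Gen.sym a], by simp [Gen.deg], by simp [sym]⟩

theorem eta_mem : (eta : KMW F) ∈ degGroup F (-1) :=
  AddSubgroup.subset_closure ⟨[Gen.eta], by simp [Gen.deg], by simp [eta]⟩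

theorem mul_mem {n m : ℤ} {x y : KMW F} (hx : x ∈ degGroup F n) (hy : y ∈ degGroup F m) :
    x * y ∈ degGroup F (n + m) := by
  induction hx using AddSubgroup.closure_induction with
  | mem x hx =>
    induction hy using AddSubgroup.closure_induction with
    | mem y hy =>
      obtain ⟨l, hl, rfl⟩ := hx
      obtain ⟨l', hl', rfl⟩ := hy
      exact AddSubgroup.subset_closure ⟨l ++ l', by simp [hl, hl'], by simp⟩
    | zero => rw [mul_zero]; exact zero_mem _
    | add y z _ _ h1 h2 => rw [mul_add]; exact add_mem h1 h2
    | neg y _ h => rw [mul_neg]; exact neg_mem h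
  | zero => rw [zero_mul]; exact zero_mem _
  | add x z _ _ h1 h2 => rw [add_mul]; exact add_mem h1 h2
  | neg x _ h => rw [neg_mul]; exact neg_mem h

theorem intCast_mem (n : ℤ) : (n : KMW F) ∈ degGroup F 0 := by
  rw [← zsmul_one]; exact zsmul_mem one_mem n

theorem form_mem (a : Fˣ) : form a ∈ degGroup F 0 :=
  add_mem one_mem (by simpa using mul_mem eta_mem (sym_mem a))

theorem epsInt_mem (n : ℤ) : epsInt F n ∈ degGroup F 0 :=
  add_mem (by simpa using mul_mem (intCast_mem _) (add_mem one_mem (form_mem (-1))))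
    (intCast_mem _)

theorem eps_mem : eps F ∈ degGroup F 0 := neg_mem (form_mem _)

variable (F)

/-- The ring homomorphism `ℤ[Fˣ] → K^MW_0(F) ⊆ K^MW_*(F)`, `u ↦ ⟨u⟩`. -/
noncomputable def groupRingHom : MonoidAlgebra ℤ Fˣ →+* KMW F :=
  (MonoidAlgebra.lift ℤ (KMW F) Fˣ (formHom F)).toRingHom

noncomputable instance : Module (MonoidAlgebra ℤ Fˣ) (KMW F) :=
  Module.compHom (KMW F) (groupRingHom F)

variable {F}

theorem smul_def (r : MonoidAlgebra ℤ Fˣ) (x : KMW F) : r • x = groupRingHom F r * x := rfl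

theorem groupRingHom_of (u : Fˣ) : groupRingHom F (MonoidAlgebra.of ℤ Fˣ u) = form u := by
  simp [groupRingHom, formHom]

theorem groupRingHom_mem (r : MonoidAlgebra ℤ Fˣ) : groupRingHom F r ∈ degGroup F 0 := by
  induction r using MonoidAlgebra.induction_on with
  | of u => rw [groupRingHom_of]; exact form_mem u
  | add x y hx hy => rw [map_add]; exact add_mem hx hy
  | smul n x hx => rw [map_zsmul]; exact zsmul_mem hx n

variable (F)

/-- `K^MW_n(F)`, the homogeneous part of degree `n`, as a module over the group ring `ℤ[Fˣ]`
in which `u` acts as multiplication by `⟨u⟩`. -/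
noncomputable def deg (n : ℤ) : Submodule (MonoidAlgebra ℤ Fˣ) (KMW F) where
  __ := degGroup F n
  smul_mem' r x hx := by
    have := mul_mem (groupRingHom_mem r) hx
    rwa [zero_add] at this

variable {F}

theorem mem_deg {n : ℤ} {x : KMW F} : x ∈ deg F n ↔ x ∈ degGroup F n := Iff.rfl

theorem form_mul_mem {n : ℤ} (u : Fˣ) {x : KMW F} (hx : x ∈ deg F n) : form u * x ∈ deg F n := by
  have := mul_mem (form_mem u) hx
  rwa [zero_add] at this

end graded

section functoriality

variable {F E : Type*} [Field F] [Field E] (f : F →+* E)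

/-- Functoriality in the field: `[a] ↦ [f a]`, `η ↦ η`. -/
noncomputable def map : KMW F →+* KMW E :=
  lift (fun a => sym (Units.map f a)) eta
    (fun a b h => steinberg (by
      simp only [Units.coe_map, MonoidHom.coe_coe]; rw [← map_add, h, map_one]))
    (fun a b => by rw [map_mul, sym_mul])
    (fun a => eta_sym _)
    (by
      have : Units.map (f : F →* E) (-1) = -1 := by ext; simp
      rw [this]; exact eta_hyp)

theorem map_sym (a : Fˣ) : map f (sym a) = sym (Units.map f a) := lift_sym a

theorem map_eta : map f (eta : KMW F) = eta := lift_eta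

theorem map_form (a : Fˣ) : map f (form a) = form (Units.map f a) := by
  simp [form, map_sym, map_eta]

theorem gen_induction {n : ℤ} {P : ℤ → KMW F → Prop} (h1 : P 0 1)
    (hsym : ∀ n a x, P n x → P (1 + n) (sym a * x))
    (heta : ∀ n x, P n x → P (-1 + n) (eta * x))
    (h0 : P n 0) (hadd : ∀ x y, P n x → P n y → P n (x + y)) (hneg : ∀ x, P n x → P n (-x))
    {x : KMW F} (hx : x ∈ degGroup F n) : P n x := by
  induction hx using AddSubgroup.closure_induction with
  | mem x hx =>
    obtain ⟨l, rfl, rfl⟩ := hx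
    clear h0 hadd hneg
    induction l with
    | nil => simpa using h1
    | cons g l ih =>
      cases g with
      | sym a => simpa [Gen.deg, sym] using hsym _ a _ ih
      | eta => simpa [Gen.deg, eta] using heta _ _ ih
  | zero => exact h0
  | add x y _ _ h1 h2 => exact hadd _ _ h1 h2
  | neg x _ h => exact hneg _ h

theorem map_mem {n : ℤ} {x : KMW F} (hx : x ∈ deg F n) : map f x ∈ deg E n := by
  refine gen_induction (P := fun n x => map f x ∈ degGroup E n) ?_ ?_ ?_ ?_ ?_ ?_
    (mem_deg.mp hx)
  · rw [map_one]; exact one_mem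
  · intro n a x h
    rw [map_mul, map_sym]; exact mul_mem (sym_mem _) h
  · intro n x h
    rw [map_mul, map_eta]; exact mul_mem eta_mem h
  · rw [map_zero]; exact zero_mem _
  · intro x y hx hy
    rw [map_add]; exact add_mem hx hy
  · intro x hx
    rw [map_neg]; exact neg_mem hx

end functoriality

section residueDegree

variable {A K κ : Type*} [CommRing A] [IsDomain A] [WfDvdMonoid A] [Field K]
    [Algebra A K] [IsFractionRing A K] [Field κ] (v : ResidueDatum A K κ)

theorem residue_mem {n : ℤ} {x : KMW K} (hx : x ∈ deg K n) : residue v x ∈ deg κ (n - 1) := by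
  suffices h : residueMatrix v x 0 0 ∈ degGroup κ n ∧ residue v x ∈ degGroup κ (n - 1) from h.2
  refine gen_induction (P := fun n x => residueMatrix v x 0 0 ∈ degGroup κ n ∧
    residue v x ∈ degGroup κ (n - 1)) ?_ ?_ ?_ ?_ ?_ ?_ (mem_deg.mp hx)
  · have e1 : residueMatrix v 1 0 0 = 1 := by simp
    have e2 : residue v 1 = 0 := by simp [residue]
    rw [e1, e2]
    exact ⟨one_mem, zero_mem _⟩
  · rintro n a x ⟨h0, h1⟩
    rw [residue_mul]
    constructor
    · simpa [Matrix.mul_apply, Fin.sum_univ_two, residueMatrix_sym, symMatrix] using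
        mul_mem (sym_mem _) h0
    · refine add_mem ?_ ?_
      · have := mul_mem (mul_mem (epsInt_mem (v.ord a)) (form_mem (v.lead a))) h0
        simpa [residue, residueMatrix_sym, symMatrix] using this
      · have := mul_mem (mul_mem (eps_mem) (sym_mem ((-1) ^ v.ord a * v.lead a))) h1
        rw [show (0 : ℤ) + 1 + (n - 1) = 1 + n - 1 by ring] at this
        simpa [residueMatrix_sym, symMatrix] using this
  · rintro n x ⟨h0, h1⟩
    rw [residue_eta_mul]
    constructor
    · simpa [Matrix.mul_apply, Fin.sum_univ_two, residueMatrix_eta, etaMatrix] using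
        mul_mem eta_mem h0
    · have := mul_mem eta_mem h1
      rwa [show (-1 : ℤ) + (n - 1) = -1 + n - 1 by ring] at this
  · simp
  · rintro x y ⟨h0, h1⟩ ⟨h0', h1'⟩
    exact ⟨by simpa using add_mem h0 h0', by simpa using add_mem h1 h1'⟩
  · rintro x ⟨h0, h1⟩
    exact ⟨by simpa using h0, by simpa using h1⟩

theorem residue_form_mul (c : Kˣ) (hc : v.ord c = 0) (α : KMW K) :
    residue v (form c * α) = form (v.lead c) * residue v α := by
  rw [residue_mul]
  have h1 : residue v (form c) = 0 := by
    simp [residue, form, residueMatrix_sym, residueMatrix_eta, hc, symMatrix_zero, etaMatrix]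
  have h2 : residueMatrix v (form c) 1 1 = form (v.lead c) := by
    simp [form, residueMatrix_sym, residueMatrix_eta, hc, symMatrix_zero, etaMatrix,
      eta_mul_eps_mul]
  rw [h1, h2, zero_mul, zero_add]

end residueDegree

end KMW
end MW

namespace MW
namespace KMW

section twist

open TensorProduct

/-- The set `L⁰` of nonzero elements of `L`. -/
abbrev NonzeroVec (L : Type*) [Zero L] := {l : L // l ≠ 0}

noncomputable instance (F : Type*) [Field F] (L : Type*) [AddCommGroup L] [Module F L] :
    MulAction Fˣ (NonzeroVec L) where
  smul u l := ⟨(u : F) • l.1, smul_ne_zero u.ne_zero l.2⟩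
  one_smul l := Subtype.ext (one_smul F l.1)
  mul_smul u w l := Subtype.ext (mul_smul (u : F) (w : F) l.1)

variable (F : Type*) [Field F] (L : Type*) [AddCommGroup L] [Module F L]

/-- The free abelian group `ℤ[L⁰]`, as a module over `ℤ[Fˣ]` (below). -/
def NonzeroVecModule (_F : Type*) (L : Type*) [Zero L] : Type _ := NonzeroVec L →₀ ℤ

noncomputable instance : AddCommGroup (NonzeroVecModule F L) :=
  inferInstanceAs (AddCommGroup (NonzeroVec L →₀ ℤ))

/-- The action of the units of `F` on `ℤ[L⁰]` that permutes the basis `L⁰`. -/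
noncomputable def unitsAction : Fˣ →* Module.End ℤ (NonzeroVecModule F L) where
  toFun u := Finsupp.lmapDomain ℤ ℤ (fun l : NonzeroVec L => u • l)
  map_one' := by
    simp only [one_smul]
    exact Finsupp.lmapDomain_id ℤ ℤ
  map_mul' u w := by
    simp only [mul_smul]
    exact Finsupp.lmapDomain_comp ℤ ℤ _ _

noncomputable instance : Module (MonoidAlgebra ℤ Fˣ) (NonzeroVecModule F L) :=
  Module.compHom _
    (MonoidAlgebra.lift ℤ (Module.End ℤ (NonzeroVecModule F L)) Fˣ (unitsAction F L)).toRingHom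

/-- Milnor-Witt K-theory of degree `n` twisted by a line `L`:
`K^MW_n(F, L) = K^MW_n(F) ⊗_{ℤ[Fˣ]} ℤ[L⁰]`.  For a graded line `(L, a)` the integer `a` does not
enter the group, only the signs in the isomorphisms between lines. -/
def Twisted (n : ℤ) : Type _ := deg F n ⊗[MonoidAlgebra ℤ Fˣ] NonzeroVecModule F L

noncomputable instance (n : ℤ) : AddCommGroup (Twisted F L n) :=
  inferInstanceAs (AddCommGroup (deg F n ⊗[MonoidAlgebra ℤ Fˣ] NonzeroVecModule F L))

variable {L}

/-- The basis element of `ℤ[L⁰]` at `l`. -/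
noncomputable def vec (l : NonzeroVec L) : NonzeroVecModule F L :=
  Finsupp.single l (1 : ℤ)

variable {F}

/-- The element `α ⊗ l`. -/
noncomputable def tw {n : ℤ} (α : deg F n) (l : NonzeroVec L) : Twisted F L n :=
  α ⊗ₜ[MonoidAlgebra ℤ Fˣ] vec F l

/-- `α ↦ α ⊗ l`. -/
noncomputable def twHom {n : ℤ} (l : NonzeroVec L) : deg F n →+ Twisted F L n where
  toFun α := tw α l
  map_zero' := TensorProduct.zero_tmul _ _
  map_add' _ _ := TensorProduct.add_tmul _ _ _

/-- `α ↦ ⟨u⟩ α`. -/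
noncomputable def formMul {n : ℤ} (u : Fˣ) (α : deg F n) : deg F n :=
  ⟨form u * α.1, form_mul_mem u α.2⟩

theorem of_smul_eq {n : ℤ} (u : Fˣ) (α : deg F n) :
    (MonoidAlgebra.of ℤ Fˣ u) • α = formMul u α :=
  Subtype.ext (by
    rw [Submodule.coe_smul, smul_def, groupRingHom_of]; rfl)

theorem of_smul_vec (u : Fˣ) (l : NonzeroVec L) :
    (MonoidAlgebra.of ℤ Fˣ u) • vec F l = vec F (u • l) := by
  have h : (MonoidAlgebra.of ℤ Fˣ u) • vec F l = unitsAction F L u (vec F l) := by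
    change (MonoidAlgebra.lift ℤ (Module.End ℤ (NonzeroVecModule F L)) Fˣ (unitsAction F L)
      (MonoidAlgebra.of ℤ Fˣ u)) (vec F l) = _
    rw [MonoidAlgebra.lift_of]
  rw [h]
  exact Finsupp.mapDomain_single

theorem tw_formMul {n : ℤ} (u : Fˣ) (α : deg F n) (l : NonzeroVec L) :
    tw (formMul u α) l = tw α (u • l) := by
  rw [tw, tw, ← of_smul_eq, ← of_smul_vec]
  exact TensorProduct.smul_tmul _ _ _

/-- The biadditive map underlying `twLift`. -/
noncomputable def twLiftAux {n : ℤ} {P : Type*} [AddCommGroup P]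
    (g : NonzeroVec L → deg F n →+ P) : deg F n →+ NonzeroVecModule F L →+ P :=
  AddMonoidHom.flip (Finsupp.liftAddHom fun l => (zmultiplesHom (deg F n →+ P)) (g l) :
    (NonzeroVec L →₀ ℤ) →+ deg F n →+ P)

theorem twLiftAux_vec {n : ℤ} {P : Type*} [AddCommGroup P]
    (g : NonzeroVec L → deg F n →+ P) (α : deg F n) (l : NonzeroVec L) :
    twLiftAux g α (vec F l) = g l α := by
  have h : (Finsupp.liftAddHom fun l => (zmultiplesHom (deg F n →+ P)) (g l) :
    (NonzeroVec L →₀ ℤ) →+ deg F n →+ P) (Finsupp.single l 1) = g l := by simp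
  exact DFunLike.congr_fun h α

theorem nonzeroVecModule_induction {P : NonzeroVecModule F L → Prop} (x : NonzeroVecModule F L)
    (h0 : P 0) (hadd : ∀ x y, P x → P y → P (x + y)) (hneg : ∀ x, P x → P (-x))
    (hv : ∀ l, P (vec F l)) : P x := by
  have key : x ∈ AddSubgroup.closure (Set.range (vec F (L := L))) := by
    change NonzeroVec L →₀ ℤ at x
    induction x using Finsupp.induction_linear with
    | zero => exact zero_mem (AddSubgroup.closure (Set.range (vec F (L := L))))
    | add f g hf hg => exact add_mem hf hg
    | single l c =>
      have : Finsupp.single l c = c • Finsupp.single l (1 : ℤ) := by simp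
      rw [this]
      exact zsmul_mem (AddSubgroup.subset_closure (Set.mem_range_self (f := vec F (L := L)) l)) c
  induction key using AddSubgroup.closure_induction with
  | mem x hx => obtain ⟨l, rfl⟩ := hx; exact hv l
  | zero => exact h0
  | add x y _ _ h1 h2 => exact hadd _ _ h1 h2
  | neg x _ h => exact hneg _ h

/-- A homomorphism out of a twisted group, given by its values `g l α` on the elements `α ⊗ l`. -/
noncomputable def twLift {n : ℤ} {P : Type*} [AddCommGroup P]
    (g : NonzeroVec L → deg F n →+ P)
    (hg : ∀ (u : Fˣ) l α, g (u • l) α = g l (formMul u α)) : Twisted F L n →+ P :=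
  TensorProduct.liftAddHom (R := MonoidAlgebra ℤ Fˣ) (twLiftAux g) (by
    intro r α x
    induction r using MonoidAlgebra.induction_on with
    | of u =>
      induction x using nonzeroVecModule_induction with
      | h0 => simp
      | hadd x y hx hy => rw [smul_add, map_add, map_add, hx, hy]
      | hneg x hx => rw [smul_neg, map_neg, map_neg, hx]
      | hv l => rw [of_smul_eq, of_smul_vec, twLiftAux_vec, twLiftAux_vec, hg]
    | add r s hr hs =>
      rw [add_smul, add_smul, map_add, map_add, AddMonoidHom.add_apply, hr, hs]
    | smul c r hr =>
      rw [smul_assoc, smul_assoc, map_zsmul, map_zsmul, AddMonoidHom.smul_apply, hr])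

theorem twLift_tw {n : ℤ} {P : Type*} [AddCommGroup P]
    (g : NonzeroVec L → deg F n →+ P)
    (hg : ∀ (u : Fˣ) l α, g (u • l) α = g l (formMul u α)) (α : deg F n) (l : NonzeroVec L) :
    twLift g hg (tw α l) = g l α := by
  exact (TensorProduct.liftAddHom_tmul _ _ _ _).trans (twLiftAux_vec g α l)

theorem twisted_induction {n : ℤ} {P : Twisted F L n → Prop} (x : Twisted F L n)
    (h0 : P 0) (hadd : ∀ x y, P x → P y → P (x + y))
    (ht : ∀ α l, P (tw α l)) : P x := by
  change deg F n ⊗[MonoidAlgebra ℤ Fˣ] NonzeroVecModule F L at x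
  induction x using TensorProduct.induction_on with
  | zero => exact h0
  | add x y hx hy => exact hadd _ _ hx hy
  | tmul α x =>
    revert α
    induction x using nonzeroVecModule_induction with
    | h0 => intro α; rw [TensorProduct.tmul_zero]; exact h0
    | hadd x y hx hy => intro α; rw [TensorProduct.tmul_add]; exact hadd _ _ (hx α) (hy α)
    | hneg x hx =>
      intro α
      rw [TensorProduct.tmul_neg, ← TensorProduct.neg_tmul]; exact hx (-α)
    | hv l => intro α; exact ht α l

/-- The action of an isomorphism of lines on nonzero elements. -/
def NonzeroVec.map {L' : Type*} [AddCommGroup L'] [Module F L'] (e : L ≃ₗ[F] L')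
    (l : NonzeroVec L) : NonzeroVec L' :=
  ⟨e l.1, fun h => l.2 ((map_eq_zero_iff e e.injective).mp h)⟩

/-- The isomorphism of twisted groups `α ⊗ l ↦ α ⊗ e(l)` induced by an isomorphism of lines. -/
noncomputable def twCongr {L' : Type*} [AddCommGroup L'] [Module F L'] (e : L ≃ₗ[F] L') (n : ℤ) :
    Twisted F L n →+ Twisted F L' n :=
  twLift (fun l => twHom (l.map e)) (fun u l α => by
    have h : (u • l).map e = u • l.map e := Subtype.ext (map_smul e (u : F) l.1)
    rw [h]
    exact (tw_formMul u α _).symm)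

end twist
end KMW
end MW

namespace MW
open TensorProduct KaehlerDifferential Polynomial

section det

/-- The determinant line: the top exterior power. -/
abbrev Det (E V : Type*) [Field E] [AddCommGroup V] [Module E V] : Type _ :=
  ⋀[E]^(Module.finrank E V) V

theorem ιMulti_basis_ne_zero {E V : Type*} [Field E] [AddCommGroup V] [Module E V] {n : ℕ}
    (b : Module.Basis (Fin n) E V) : ExteriorAlgebra.ιMulti E n b ≠ 0 := by
  intro h
  have h0 : exteriorPower.ιMulti E n (b : Fin n → V) = 0 := Subtype.ext h
  have h1 := exteriorPower.alternatingMapLinearEquiv_apply_ιMulti b.det b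
  rw [h0, map_zero, Module.Basis.det_self] at h1
  exact zero_ne_one h1

theorem finrank_det (E V : Type*) [Field E] [AddCommGroup V] [Module E V]
    [Module.Finite E V] : Module.finrank E (Det E V) = 1 := by
  rw [exteriorPower.finrank_eq, Nat.choose_self]

variable {A B M N : Type*} [CommRing A] [CommRing B] [Algebra A B] [AddCommGroup M] [Module A M]
  [AddCommGroup N] [Module A N] [Module B N] [IsScalarTower A B N]

/-- The map of exterior algebras induced by a map of modules that is linear over `A → B`. -/
noncomputable def extMap (f : M →ₗ[A] N) : ExteriorAlgebra A M →ₐ[A] ExteriorAlgebra B N :=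
  ExteriorAlgebra.lift A ⟨(ExteriorAlgebra.ι B).restrictScalars A ∘ₗ f, fun m => by
    simp⟩

theorem extMap_ι (f : M →ₗ[A] N) (m : M) :
    extMap (B := B) f (ExteriorAlgebra.ι A m) = ExteriorAlgebra.ι B (f m) := by
  simp [extMap]

theorem extMap_ιMulti (f : M →ₗ[A] N) {n : ℕ} (v : Fin n → M) :
    extMap (B := B) f (ExteriorAlgebra.ιMulti A n v) = ExteriorAlgebra.ιMulti B n (f ∘ v) := by
  rw [ExteriorAlgebra.ιMulti_apply, ExteriorAlgebra.ιMulti_apply, map_list_prod, List.map_ofFn]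
  congr 2
  funext i
  exact extMap_ι f (v i)

theorem extMap_mem (f : M →ₗ[A] N) {n : ℕ} {x : ExteriorAlgebra A M} (hx : x ∈ ⋀[A]^n M) :
    extMap (B := B) f x ∈ ⋀[B]^n N := by
  rw [← exteriorPower.ιMulti_span_fixedDegree] at hx
  induction hx using Submodule.span_induction with
  | mem x hx =>
    obtain ⟨v, rfl⟩ := hx
    rw [extMap_ιMulti]
    exact ExteriorAlgebra.ιMulti_range B n ⟨_, rfl⟩
  | zero => rw [map_zero]; exact zero_mem _
  | add x y _ _ h1 h2 => rw [map_add]; exact add_mem h1 h2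
  | smul a x _ h =>
    rw [map_smul, ← algebraMap_smul B a]
    exact Submodule.smul_mem _ _ h

end det

section differentials

variable (k F : Type*) [Field k] [Field F] [Algebra k F]

theorem mapBaseChange_poly_injective : Function.Injective (mapBaseChange k F F[X]) := by
  rw [injective_iff_map_eq_zero]
  intro x hx
  obtain ⟨x, rfl⟩ := (Algebra.H1Cotangent.exact_δ_mapBaseChange k F F[X] x).mp hx
  rw [Subsingleton.elim x 0, map_zero]

variable {k F} in
/-- The differentials `e₁, …, e_r, dt` of `F[t]`, where the `e_i` form a basis of the
differentials of `F`. -/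
noncomputable def polyFamily {r : ℕ} (e : Module.Basis (Fin r) F Ω[F⁄k]) :
    Fin (r + 1) → Ω[F[X]⁄k] :=
  Fin.snoc (fun i => KaehlerDifferential.map k k F F[X] (e i)) (D k F[X] X)

variable {k F}

theorem polynomial_D_X_ne (b : F[X]) (h : b • D F F[X] (X : F[X]) = 0) : b = 0 := by
  have := congrArg (KaehlerDifferential.polynomialEquiv F) h
  simpa using this

theorem linearIndependent_polyFamily {r : ℕ} (e : Module.Basis (Fin r) F Ω[F⁄k]) :
    LinearIndependent F[X] (polyFamily e) := by
  rw [Fintype.linearIndependent_iff]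
  intro g hg
  rw [Fin.sum_univ_castSucc] at hg
  simp only [polyFamily, Fin.snoc_castSucc, Fin.snoc_last] at hg
  have h1 := congrArg (KaehlerDifferential.map k F F[X] F[X]) hg
  have hz : ∀ w : Ω[F⁄k], KaehlerDifferential.map k F F[X] F[X] (KaehlerDifferential.map k k F F[X] w) = 0 := by
    intro w
    have := (KaehlerDifferential.exact_mapBaseChange_map k F F[X]).apply_apply_eq_zero (1 ⊗ₜ w)
    simpa using this
  have hl : g (Fin.last r) = 0 := by
    apply polynomial_D_X_ne
    simpa [hz] using h1
  rw [hl, zero_smul, add_zero] at hg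
  have h2 : mapBaseChange k F F[X] (∑ i : Fin r, g i.castSucc ⊗ₜ e i) = 0 := by
    simpa using hg
  have h3 := mapBaseChange_poly_injective k F (h2.trans (map_zero _).symm)
  have h4 : ∑ i : Fin r, g i.castSucc • (e.baseChange F[X]) i = 0 := by
    simpa [Module.Basis.baseChange_apply, TensorProduct.smul_tmul'] using h3
  have h5 := Fintype.linearIndependent_iff.mp (e.baseChange F[X]).linearIndependent _ h4
  intro i
  induction i using Fin.lastCases with
  | last => exact hl
  | cast i => exact h5 i

theorem span_polyFamily {r : ℕ} (e : Module.Basis (Fin r) F Ω[F⁄k]) :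
    ⊤ ≤ Submodule.span F[X] (Set.range (polyFamily e)) := by
  have hX : D k F[X] X ∈ Submodule.span F[X] (Set.range (polyFamily e)) :=
    Submodule.subset_span ⟨Fin.last r, by simp [polyFamily]⟩
  have he : ∀ w : Ω[F⁄k], KaehlerDifferential.map k k F F[X] w ∈
      Submodule.span F[X] (Set.range (polyFamily e)) := by
    intro w
    rw [← e.sum_repr w, map_sum]
    refine sum_mem fun i _ => ?_
    rw [map_smul, ← algebraMap_smul F[X]]
    exact Submodule.smul_mem _ _ (Submodule.subset_span ⟨i.castSucc, by simp [polyFamily]⟩)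
  rw [← KaehlerDifferential.span_range_derivation k F[X], Submodule.span_le]
  rintro _ ⟨q, rfl⟩
  induction q using Polynomial.induction_on' with
  | add p q hp hq => rw [map_add]; exact add_mem hp hq
  | monomial n a =>
    rw [← Polynomial.C_mul_X_pow_eq_monomial, Derivation.leibniz, Derivation.leibniz_pow]
    refine add_mem (Submodule.smul_mem _ _ ?_) (Submodule.smul_mem _ _ ?_)
    · exact Submodule.smul_of_tower_mem _ _ (Submodule.smul_mem _ _ hX)
    · have := he (D k F a)
      rwa [KaehlerDifferential.map_D] at this

/-- `e₁, …, e_r, dt` is a basis of the differentials of `F[t]` over `k`. -/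
noncomputable def polyBasis {r : ℕ} (e : Module.Basis (Fin r) F Ω[F⁄k]) :
    Module.Basis (Fin (r + 1)) F[X] Ω[F[X]⁄k] :=
  Module.Basis.mk (linearIndependent_polyFamily e) (span_polyFamily e)

/-- `e₁, …, e_r, dt` is a basis of the differentials of `F(t)` over `k`. -/
noncomputable def ratBasis {r : ℕ} (e : Module.Basis (Fin r) F Ω[F⁄k]) :
    Module.Basis (Fin (r + 1)) (RatFunc F) Ω[RatFunc F⁄k] :=
  (polyBasis e).ofIsLocalizedModule (RatFunc F) (nonZeroDivisors F[X])
    (KaehlerDifferential.map k k F[X] (RatFunc F))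

end differentials
end MW

namespace MW
open TensorProduct KaehlerDifferential Polynomial KMW

section shortExact

variable {E V₁ V₂ V₃ : Type*} [Field E] [AddCommGroup V₁] [Module E V₁] [AddCommGroup V₂]
  [Module E V₂] [AddCommGroup V₃] [Module E V₃]

theorem wedge_mem {n : ℕ} (x : V₂) {y : ExteriorAlgebra E V₂} (hy : y ∈ ⋀[E]^n V₂) :
    ExteriorAlgebra.ι E x * y ∈ ⋀[E]^(n + 1) V₂ := by
  rw [ExteriorAlgebra.exteriorPower, pow_succ']
  exact Submodule.mul_mem_mul ⟨x, rfl⟩ hy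

theorem mem_wedge {n : ℕ} (x : V₂) {y : ExteriorAlgebra E V₂} (hy : y ∈ ⋀[E]^n V₂) :
    y * ExteriorAlgebra.ι E x ∈ ⋀[E]^(n + 1) V₂ := by
  rw [ExteriorAlgebra.exteriorPower, pow_succ]
  exact Submodule.mul_mem_mul hy ⟨x, rfl⟩

theorem map_mem_exteriorPower (s : V₃ →ₗ[E] V₂) {n : ℕ} {y : ExteriorAlgebra E V₃}
    (hy : y ∈ ⋀[E]^n V₃) : ExteriorAlgebra.map s y ∈ ⋀[E]^n V₂ := by
  have : ExteriorAlgebra.map s y = extMap (B := E) s y := by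
    have h : ExteriorAlgebra.map s = extMap (B := E) s := by
      ext v
      simp [extMap_ι]
    rw [h]
  rw [this]
  exact extMap_mem s hy

/-- Given `i : V₁ → V₂` and `s : V₃ → V₂`, with `dim V₂ = dim V₃ + 1`, the map
`x ⊗ (w₁ ∧ ⋯ ∧ w_r) ↦ i x ∧ s w₁ ∧ ⋯ ∧ s w_r`.  If `0 → V₁ → V₂ → V₃ → 0` is exact, `V₁` is a line
and `s` is a section, this is the canonical isomorphism `det V₁ ⊗ det V₃ ≅ det V₂`, which does not
depend on `s`. -/
noncomputable def lineDet (i : V₁ →ₗ[E] V₂) (s : V₃ →ₗ[E] V₂)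
    (hdim : Module.finrank E V₂ = Module.finrank E V₃ + 1) :
    V₁ →ₗ[E] Det E V₃ →ₗ[E] Det E V₂ :=
  LinearMap.mk₂ E
    (fun x ω => ⟨ExteriorAlgebra.ι E (i x) * ExteriorAlgebra.map s ω.1, by
      rw [hdim]; exact wedge_mem _ (map_mem_exteriorPower s ω.2)⟩)
    (fun x x' ω => Subtype.ext (by simp [add_mul]))
    (fun c x ω => Subtype.ext (by simp))
    (fun x ω ω' => Subtype.ext (by simp [mul_add]))
    (fun c x ω => Subtype.ext (by simp))

theorem lineDet_ne_zero [Module.Finite E V₂] [Module.Finite E V₃]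
    {i : V₁ →ₗ[E] V₂} {q : V₂ →ₗ[E] V₃} {s : V₃ →ₗ[E] V₂}
    (hdim : Module.finrank E V₂ = Module.finrank E V₃ + 1) (hi : Function.Injective i)
    (hiq : ∀ x, q (i x) = 0) (hs : q ∘ₗ s = LinearMap.id) {x : V₁} (hx : x ≠ 0) {ω : Det E V₃}
    (hω : ω ≠ 0) : lineDet i s hdim x ω ≠ 0 := by
  set e := Module.finBasis E V₃
  have hsinj : Function.Injective s := fun a b h => by
    have := congrArg q h
    simpa [← LinearMap.comp_apply, hs] using this
  have hqs : ∀ w, q (s w) = w := fun w => by rw [← LinearMap.comp_apply, hs]; rfl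
  have hv : LinearIndependent E (Fin.cons (i x) (s ∘ e) : Fin (Module.finrank E V₃ + 1) → V₂) := by
    rw [linearIndependent_finCons]
    refine ⟨e.linearIndependent.map' s (LinearMap.ker_eq_bot.mpr hsinj), fun hmem => ?_⟩
    have : i x ∈ LinearMap.range s := by
      refine Submodule.span_le.mpr ?_ hmem
      rintro _ ⟨j, rfl⟩
      exact ⟨_, rfl⟩
    obtain ⟨w, hw⟩ := this
    have h1 := hiq x
    rw [← hw, hqs] at h1
    rw [h1, map_zero] at hw
    exact hx (hi (hw.symm.trans (map_zero i).symm))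
  let b := basisOfLinearIndependentOfCardEqFinrank hv (by simp [hdim])
  have hb : (b : Fin (Module.finrank E V₃ + 1) → V₂) = Fin.cons (i x) (s ∘ e) :=
    coe_basisOfLinearIndependentOfCardEqFinrank _ _
  have hne : exteriorPower.ιMulti E _ e ≠ 0 := fun h =>
    ιMulti_basis_ne_zero e (congrArg Subtype.val h)
  obtain ⟨c, rfl⟩ := exists_smul_eq_of_finrank_eq_one (finrank_det E V₃) hne ω
  have hc : c ≠ 0 := by rintro rfl; exact hω (zero_smul _ _)
  rw [map_smul]
  refine smul_ne_zero hc fun h => ιMulti_basis_ne_zero b ?_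
  have h' := congrArg Subtype.val h
  rw [hb]
  have e1 : ExteriorAlgebra.ιMulti E (Module.finrank E V₃ + 1)
      (Fin.cons (i x) (s ∘ e) : Fin (Module.finrank E V₃ + 1) → V₂) =
      ExteriorAlgebra.ι E (i x) * ExteriorAlgebra.map s (ExteriorAlgebra.ιMulti E _ e) := by
    rw [ExteriorAlgebra.ιMulti_succ_apply, ExteriorAlgebra.map_apply_ιMulti]
    rfl
  rw [e1]
  exact h'

/-- The dual of `V`. -/
def LineDual (E V : Type*) [Field E] [AddCommGroup V] [Module E V] : Type _ := Module.Dual E V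

noncomputable instance (E V : Type*) [Field E] [AddCommGroup V] [Module E V] :
    AddCommGroup (LineDual E V) := inferInstanceAs (AddCommGroup (Module.Dual E V))

noncomputable instance (E V : Type*) [Field E] [AddCommGroup V] [Module E V] :
    Module E (LineDual E V) := inferInstanceAs (Module E (Module.Dual E V))

/-- The element dual to the basis vector of a line. -/
noncomputable def dualVec (b : Module.Basis Unit E V₁) : LineDual E V₁ := b.coord ()

theorem dualVec_ne_zero (b : Module.Basis Unit E V₁) : dualVec b ≠ 0 := fun h => by
  have h1 : b.coord () = 0 := h
  have h2 : b.coord () (b ()) = 0 := by rw [h1]; rfl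
  simp at h2

theorem finrank_lineDual (b : Module.Basis Unit E V₁) : Module.finrank E (LineDual E V₁) = 1 := by
  have : Module.Finite E V₁ := Module.Finite.of_basis b
  refine (Subspace.dual_finrank_eq (K := E) (V := V₁)).trans ?_
  rw [Module.finrank_eq_card_basis b, Fintype.card_unit]

theorem finite_lineDual (b : Module.Basis Unit E V₁) : Module.Finite E (LineDual E V₁) :=
  have : Module.Finite E V₁ := Module.Finite.of_basis b
  inferInstanceAs (Module.Finite E (Module.Dual E V₁))

theorem tmul_ne_zero_of_ne_zero {W W' : Type*} [AddCommGroup W] [Module E W] [AddCommGroup W']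
    [Module E W'] {x : W} {y : W'} (hx : x ≠ 0) (hy : y ≠ 0) : x ⊗ₜ[E] y ≠ 0 := by
  intro h
  obtain ⟨f, hf⟩ : ∃ f : Module.Dual E W, f x ≠ 0 := by
    by_contra! hc
    exact hx ((Module.forall_dual_apply_eq_zero_iff E x).mp hc)
  have h1 := congrArg (TensorProduct.lid E W' ∘ LinearMap.rTensor W' f) h
  simp only [Function.comp_apply, LinearMap.rTensor_tmul, TensorProduct.lid_tmul, map_zero] at h1
  exact smul_ne_zero hf hy h1

/-- For an exact sequence `0 → V₁ → V₂ → V₃ → 0` with `V₁` a line with basis vector `b` and `s` a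
section, the isomorphism `det V₃ → V₁^∨ ⊗ det V₂` obtained from `(V₁, 1) ⊗ D(V₃) ≅ D(V₂)` by
tensoring on the left with `(V₁^∨, -1)`.  The contraction `(V₁^∨, -1) ⊗ (V₁, 1) ≅ (E, 0)` of graded
lines is *minus* the evaluation, by the sign rule for graded lines, so `1` corresponds to
`-(b^* ⊗ b)` and the map is `ω ↦ -b^* ⊗ (b ∧ s ω)`.  It depends neither on `b` nor on `s`. -/
noncomputable def coDet (i : V₁ →ₗ[E] V₂) (s : V₃ →ₗ[E] V₂)
    (hdim : Module.finrank E V₂ = Module.finrank E V₃ + 1) (b : Module.Basis Unit E V₁) :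
    Det E V₃ →ₗ[E] LineDual E V₁ ⊗[E] Det E V₂ :=
  TensorProduct.mk E (LineDual E V₁) (Det E V₂) (-dualVec b) ∘ₗ lineDet i s hdim (b ())

theorem coDet_bijective [Module.Finite E V₂] [Module.Finite E V₃]
    {i : V₁ →ₗ[E] V₂} {q : V₂ →ₗ[E] V₃} {s : V₃ →ₗ[E] V₂}
    (hdim : Module.finrank E V₂ = Module.finrank E V₃ + 1) (hi : Function.Injective i)
    (hiq : ∀ x, q (i x) = 0) (hs : q ∘ₗ s = LinearMap.id) (b : Module.Basis Unit E V₁) :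
    Function.Bijective (coDet i s hdim b) := by
  have hinj : Function.Injective (coDet i s hdim b) := by
    rw [injective_iff_map_eq_zero]
    intro ω h
    by_contra hω
    exact tmul_ne_zero_of_ne_zero (neg_ne_zero.mpr (dualVec_ne_zero b))
      (lineDet_ne_zero hdim hi hiq hs (b.ne_zero ()) hω) h
  have := finite_lineDual b
  refine ⟨hinj, (LinearMap.injective_iff_surjective_of_finrank_eq_finrank ?_).mp hinj⟩
  rw [Module.finrank_tensorProduct, finrank_det, finrank_det, finrank_lineDual b]

end shortExact

section poly

variable (F : Type*) [Field F]

/-- The monic irreducible polynomials over `F`. -/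
abbrev MonicIrreducible : Type _ := {p : F[X] // p.Monic ∧ Irreducible p}

variable {F}

/-- `F(p) = F[t] / (p)`. -/
abbrev ResidueField (p : MonicIrreducible F) : Type _ := F[X] ⧸ Ideal.span {p.1}

instance (p : MonicIrreducible F) : (Ideal.span {p.1}).IsMaximal :=
  PrincipalIdealRing.isMaximal_of_irreducible p.2.2

noncomputable instance (p : MonicIrreducible F) : Field (ResidueField p) :=
  Ideal.Quotient.field _

/-- The `p`-adic valuation on `F(t)`, with uniformizer `p` and residue field `F(p)`. -/
noncomputable def datum (p : MonicIrreducible F) :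
    ResidueDatum F[X] (RatFunc F) (ResidueField p) where
  unif := p.1
  prime := p.2.2.prime
  red := Ideal.Quotient.mk _
  red_surjective := Ideal.Quotient.mk_surjective
  red_eq_zero_iff a := by rw [Ideal.Quotient.eq_zero_iff_mem, Ideal.mem_span_singleton]

/-- `(p) / (p)²`, which is `𝔪_p / 𝔪_p²` for the local ring of `F[t]` at `p`. -/
abbrev Conormal (p : MonicIrreducible F) : Type _ := (Ideal.span {p.1}).Cotangent

/-- The class of `p` in `(p) / (p)²`. -/
noncomputable def unifClass (p : MonicIrreducible F) : Conormal p :=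
  (Ideal.span {p.1}).toCotangent ⟨p.1, Ideal.mem_span_singleton_self _⟩

theorem unifClass_ne_zero (p : MonicIrreducible F) : unifClass p ≠ 0 := by
  rw [unifClass, Ne, Ideal.toCotangent_eq_zero, Ideal.span_singleton_pow,
    Ideal.mem_span_singleton]
  intro h
  have := p.2.2.not_isUnit
  exact this (isUnit_of_dvd_one ((mul_dvd_mul_iff_left p.2.2.ne_zero).mp (by simpa [pow_two] using h)))

theorem span_unifClass (p : MonicIrreducible F) :
    ⊤ ≤ Submodule.span (ResidueField p) (Set.range fun _ : Unit => unifClass p) := by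
  rintro x -
  obtain ⟨⟨y, hy⟩, rfl⟩ := Ideal.toCotangent_surjective _ x
  obtain ⟨a, rfl⟩ := Ideal.mem_span_singleton'.mp hy
  have : (Ideal.span {p.1}).toCotangent ⟨a * p.1, hy⟩ =
      (algebraMap F[X] (ResidueField p) a) • unifClass p := by
    rw [algebraMap_smul, unifClass, ← map_smul]
    rfl
  rw [this]
  exact Submodule.smul_mem _ _ (Submodule.subset_span ⟨(), rfl⟩)

/-- The class of `p` is a basis of the line `(p) / (p)²`. -/
noncomputable def conormalBasis (p : MonicIrreducible F) :
    Module.Basis Unit (ResidueField p) (Conormal p) :=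
  Module.Basis.mk (v := fun _ => unifClass p)
    (LinearIndependent.of_subsingleton () (unifClass_ne_zero p)) (span_unifClass p)

theorem conormalBasis_apply (p : MonicIrreducible F) : conormalBasis p () = unifClass p := by
  simp [conormalBasis]

end poly

section poly2

variable (k : Type*) {F : Type*} [Field k] [Field F] [Algebra k F]

/-- `F(p) ⊗ Ω_{F[t]/k}`. -/
abbrev ConormalTarget (p : MonicIrreducible F) : Type _ :=
  ResidueField p ⊗[F[X]] Ω[F[X]⁄k]

/-- The map `(p) / (p)² → F(p) ⊗ Ω_{F[t]/k}`, `x ↦ 1 ⊗ dx`. -/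
noncomputable def conormalMap (p : MonicIrreducible F) :
    Conormal p →ₗ[ResidueField p] ConormalTarget k p :=
  LinearMap.extendScalarsOfSurjective (R := F[X]) Ideal.Quotient.mk_surjective
   (kerCotangentToTensor k F[X] (ResidueField p) ∘ₗ
     (Ideal.Cotangent.equivOfEq _ _ (Ideal.mk_ker (I := Ideal.span {p.1})).symm).toLinearMap)

theorem conormalMap_toCotangent (p : MonicIrreducible F) (x : Ideal.span {p.1}) :
    conormalMap k p ((Ideal.span {p.1}).toCotangent x) = 1 ⊗ₜ D k F[X] x.1 := rfl

theorem mapBaseChange_conormalMap (p : MonicIrreducible F) (x : Conormal p) :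
    mapBaseChange k F[X] (ResidueField p) (conormalMap k p x) = 0 := by
  obtain ⟨⟨y, hy⟩, rfl⟩ := Ideal.toCotangent_surjective _ x
  rw [conormalMap_toCotangent, mapBaseChange_tmul, map_D, Ideal.Quotient.algebraMap_eq,
    Ideal.Quotient.eq_zero_iff_mem.mpr hy]
  simp

theorem exact_conormalMap (p : MonicIrreducible F) :
    Function.Exact (conormalMap k p) (mapBaseChange k F[X] (ResidueField p)) := by
  intro y
  refine ⟨fun h => ?_, ?_⟩
  · obtain ⟨x, rfl⟩ := (exact_kerCotangentToTensor_mapBaseChange k F[X] (ResidueField p)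
      Ideal.Quotient.mk_surjective y).mp h
    obtain ⟨x, rfl⟩ := (Ideal.Cotangent.equivOfEq _ _
      (Ideal.mk_ker (I := Ideal.span {p.1})).symm).surjective x
    exact ⟨x, rfl⟩
  · rintro ⟨x, rfl⟩
    exact mapBaseChange_conormalMap k p x

variable [Algebra.EssFiniteType k F]

/-- The basis `1 ⊗ e₁, …, 1 ⊗ e_r, 1 ⊗ dt` of `F(p) ⊗ Ω_{F[t]/k}`. -/
noncomputable def residueBasis (p : MonicIrreducible F) :
    Module.Basis (Fin (Module.finrank F Ω[F⁄k] + 1)) (ResidueField p) (ConormalTarget k p) :=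
  (polyBasis (Module.finBasis F Ω[F⁄k])).baseChange (ResidueField p)

theorem finrank_conormalTarget (p : MonicIrreducible F) :
    Module.finrank (ResidueField p) (ConormalTarget k p) = Module.finrank F Ω[F⁄k] + 1 := by
  rw [Module.finrank_eq_card_basis (residueBasis k p), Fintype.card_fin]

theorem finrank_ratFunc :
    Module.finrank (RatFunc F) Ω[RatFunc F⁄k] = Module.finrank F Ω[F⁄k] + 1 := by
  rw [Module.finrank_eq_card_basis (ratBasis (Module.finBasis F Ω[F⁄k])), Fintype.card_fin]

variable [PerfectField k]

instance essFiniteType_polynomial : Algebra.EssFiniteType k F[X] :=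
  Algebra.EssFiniteType.comp k F F[X]

instance formallySmooth_residueField (p : MonicIrreducible F) :
    Algebra.FormallySmooth k (ResidueField p) :=
  have : Algebra.EssFiniteType k (ResidueField p) := Algebra.EssFiniteType.comp k F[X] _
  Algebra.FormallySmooth.of_perfectField

instance formallySmooth_polynomial : Algebra.FormallySmooth k F[X] :=
  Algebra.FormallySmooth.comp k F F[X]

theorem conormalMap_injective (p : MonicIrreducible F) :
    Function.Injective (conormalMap k p) := by
  have h := (Algebra.FormallySmooth.kerCotangentToTensor_injective_iff (R := k) (P := F[X])
    (A := ResidueField p) Ideal.Quotient.mk_surjective).mpr inferInstance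
  exact h.comp (Ideal.Cotangent.equivOfEq _ _
      (Ideal.mk_ker (I := Ideal.span {p.1})).symm).injective

theorem finrank_residueField (p : MonicIrreducible F) :
    Module.finrank (ResidueField p) (ConormalTarget k p) =
      Module.finrank (ResidueField p) Ω[ResidueField p⁄k] + 1 := by
  have := Module.Finite.of_basis (residueBasis k p)
  have h1 := LinearMap.finrank_range_add_finrank_ker (mapBaseChange k F[X] (ResidueField p))
  have h2 : Function.Surjective (mapBaseChange k F[X] (ResidueField p)) :=
    mapBaseChange_surjective k F[X] (ResidueField p) Ideal.Quotient.mk_surjective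
  rw [LinearMap.range_eq_top.mpr h2, finrank_top, (exact_conormalMap k p).linearMap_ker_eq,
    LinearMap.finrank_range_of_inj (conormalMap_injective k p),
    Module.finrank_eq_card_basis (conormalBasis p)] at h1
  simpa using h1.symm

end poly2
end MW

namespace MW
open TensorProduct KaehlerDifferential Polynomial KMW

section ratio

variable {E L : Type*} [Field E] [AddCommGroup L] [Module E L]

theorem exists_ratio (h : Module.finrank E L = 1) (m l : NonzeroVec L) : ∃ c : Eˣ, c • m = l := by
  obtain ⟨c, hc⟩ := exists_smul_eq_of_finrank_eq_one h m.2 l.1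
  have hc0 : c ≠ 0 := by
    rintro rfl
    exact l.2 (by rw [← hc, zero_smul])
  exact ⟨Units.mk0 c hc0, Subtype.ext hc⟩

/-- The unit `c` with `c • m = l`, for nonzero elements `m`, `l` of a line. -/
noncomputable def ratio (h : Module.finrank E L = 1) (m l : NonzeroVec L) : Eˣ :=
  (exists_ratio h m l).choose

theorem ratio_smul (h : Module.finrank E L = 1) (m l : NonzeroVec L) : ratio h m l • m = l :=
  (exists_ratio h m l).choose_spec

theorem ratio_eq (h : Module.finrank E L = 1) (m l : NonzeroVec L) (c : Eˣ) (hc : c • m = l) :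
    ratio h m l = c := by
  have h1 := (ratio_smul h m l).trans hc.symm
  exact Units.ext (smul_left_injective E m.2 (congrArg Subtype.val h1))

theorem ratio_units_smul (h : Module.finrank E L = 1) (m l : NonzeroVec L) (u : Eˣ) :
    ratio h m (u • l) = u * ratio h m l :=
  ratio_eq h m _ _ (by rw [mul_smul, ratio_smul])

end ratio

section directSum

variable {ι A : Type*} {B : ι → Type*} [AddCommGroup A] [∀ i, AddCommGroup (B i)]

open Classical in
/-- The map to a direct sum given by homomorphisms `f i` such that, for every `x`, almost all of
the `f i x` vanish. -/
noncomputable def toDirectSum (f : ∀ i, A →+ B i) (hf : ∀ x, {i | f i x ≠ 0}.Finite) :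
    A →+ DirectSum ι B :=
  AddMonoidHom.mk' (fun x => DirectSum.mk B (hf x).toFinset fun i => f i.1 x) (by
    have key : ∀ x i, DirectSum.mk B (hf x).toFinset (fun i => f i.1 x) i = f i x := by
      intro x i
      by_cases h : i ∈ (hf x).toFinset
      · exact DirectSum.mk_apply_of_mem h
      · refine (DirectSum.mk_apply_of_notMem h).trans ?_
        rw [Set.Finite.mem_toFinset] at h
        exact (not_not.mp h).symm
    intro x y
    refine DFinsupp.ext fun i => ?_
    rw [key, DirectSum.add_apply, key, key, map_add])

theorem toDirectSum_apply (f : ∀ i, A →+ B i) (hf : ∀ x, {i | f i x ≠ 0}.Finite) (x : A)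
    (i : ι) : toDirectSum f hf x i = f i x := by
  classical
  change DirectSum.mk B (hf x).toFinset (fun i => f i.1 x) i = f i x
  by_cases h : i ∈ (hf x).toFinset
  · exact DirectSum.mk_apply_of_mem h
  · refine (DirectSum.mk_apply_of_notMem h).trans ?_
    rw [Set.Finite.mem_toFinset] at h
    exact (not_not.mp h).symm

end directSum

section inclusion

variable (k F : Type*) [Field k] [Field F] [Algebra k F] [Algebra.EssFiniteType k F]

/-- `l ↦ l ∧ dt`, from the determinant of the differentials of `F` to that of `F(t)`. -/
noncomputable def wedgeDt (l : Det F Ω[F⁄k]) : Det (RatFunc F) Ω[RatFunc F⁄k] :=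
  ⟨extMap (B := RatFunc F) (KaehlerDifferential.map k k F (RatFunc F)) l.1 *
      ExteriorAlgebra.ι (RatFunc F) (D k (RatFunc F) RatFunc.X), by
    rw [finrank_ratFunc k]
    exact mem_wedge _ (extMap_mem _ l.2)⟩

theorem wedgeDt_smul (c : F) (l : Det F Ω[F⁄k]) :
    wedgeDt k F (c • l) = algebraMap F (RatFunc F) c • wedgeDt k F l := by
  apply Subtype.ext
  change extMap (B := RatFunc F) _ (c • l.1) * _ = algebraMap F (RatFunc F) c • (_ * _)
  rw [map_smul, algebraMap_smul, smul_mul_assoc]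

variable {k F} in
theorem map_map_ratFunc (w : Ω[F⁄k]) :
    KaehlerDifferential.map k k F[X] (RatFunc F) (KaehlerDifferential.map k k F F[X] w) =
      KaehlerDifferential.map k k F (RatFunc F) w := by
  have hw : w ∈ Submodule.span F (Set.range (D k F)) := by
    rw [KaehlerDifferential.span_range_derivation]; trivial
  induction hw using Submodule.span_induction with
  | mem x hx =>
    obtain ⟨a, rfl⟩ := hx
    rw [map_D, map_D, map_D, ← IsScalarTower.algebraMap_apply F F[X] (RatFunc F)]
  | zero => simp only [map_zero]
  | add x y _ _ h1 h2 => simp only [map_add, h1, h2]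
  | smul c x _ h =>
    have e1 : ∀ w : Ω[F[X]⁄k], KaehlerDifferential.map k k F[X] (RatFunc F) (c • w) =
        c • KaehlerDifferential.map k k F[X] (RatFunc F) w := fun w => by
      rw [← algebraMap_smul F[X] c w, map_smul, algebraMap_smul]
    rw [map_smul, e1, h, map_smul]

variable {k F} in
theorem ratBasis_castSucc {r : ℕ} (e : Module.Basis (Fin r) F Ω[F⁄k]) (i : Fin r) :
    ratBasis e i.castSucc = KaehlerDifferential.map k k F (RatFunc F) (e i) := by
  rw [ratBasis, Module.Basis.ofIsLocalizedModule_apply, polyBasis, Module.Basis.mk_apply,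
    polyFamily, Fin.snoc_castSucc]
  exact map_map_ratFunc (e i)

variable {k F} in
theorem ratBasis_last {r : ℕ} (e : Module.Basis (Fin r) F Ω[F⁄k]) :
    ratBasis e (Fin.last r) = D k (RatFunc F) RatFunc.X := by
  rw [ratBasis, Module.Basis.ofIsLocalizedModule_apply, polyBasis, Module.Basis.mk_apply,
    polyFamily, Fin.snoc_last, KaehlerDifferential.map_D, RatFunc.algebraMap_X]

variable {k F} in
theorem extMap_mul_eq {r : ℕ} (e : Module.Basis (Fin r) F Ω[F⁄k]) :
    extMap (B := RatFunc F) (KaehlerDifferential.map k k F (RatFunc F))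
      (ExteriorAlgebra.ιMulti F r e) *
      ExteriorAlgebra.ι (RatFunc F) (D k (RatFunc F) RatFunc.X) =
    ExteriorAlgebra.ιMulti (RatFunc F) (r + 1) (ratBasis e) := by
  rw [extMap_ιMulti, ExteriorAlgebra.ιMulti_apply, ExteriorAlgebra.ιMulti_apply, List.ofFn_succ',
    List.prod_concat, ratBasis_last]
  congr 3
  funext i
  rw [ratBasis_castSucc]
  rfl

theorem wedgeDt_ne_zero {l : Det F Ω[F⁄k]} (hl : l ≠ 0) : wedgeDt k F l ≠ 0 := by
  set e := Module.finBasis F Ω[F⁄k]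
  have hne : exteriorPower.ιMulti F _ e ≠ 0 := fun h =>
    ιMulti_basis_ne_zero e (congrArg Subtype.val h)
  obtain ⟨c, rfl⟩ := exists_smul_eq_of_finrank_eq_one (finrank_det F Ω[F⁄k]) hne l
  have hc : c ≠ 0 := by rintro rfl; exact hl (zero_smul _ _)
  rw [wedgeDt_smul]
  refine smul_ne_zero (by simpa using hc) fun h => ιMulti_basis_ne_zero (ratBasis e) ?_
  rw [← extMap_mul_eq]
  exact congrArg Subtype.val h

/-- `l ↦ l ∧ dt` on nonzero elements. -/
noncomputable def wedgeDtVec (l : NonzeroVec (Det F Ω[F⁄k])) :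
    NonzeroVec (Det (RatFunc F) Ω[RatFunc F⁄k]) :=
  ⟨wedgeDt k F l.1, wedgeDt_ne_zero k F l.2⟩

/-- The homomorphism `α ⊗ l ↦ α_{F(t)} ⊗ (l ∧ dt)`. -/
noncomputable def inclusion (n : ℤ) :
    Twisted F (Det F Ω[F⁄k]) n →+ Twisted (RatFunc F) (Det (RatFunc F) Ω[RatFunc F⁄k]) n :=
  twLift
    (fun l => (twHom (wedgeDtVec k F l)).comp
      (AddMonoidHom.mk' (fun α : deg F n =>
        (⟨KMW.map (algebraMap F (RatFunc F)) α.1, map_mem _ α.2⟩ : deg (RatFunc F) n))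
        (fun α β => Subtype.ext (map_add _ _ _))))
    (fun u l α => by
      have h : wedgeDtVec k F (u • l) =
          Units.map (algebraMap F (RatFunc F) : F →* RatFunc F) u • wedgeDtVec k F l :=
        Subtype.ext (wedgeDt_smul k F (u : F) l.1)
      change tw _ _ = tw _ _
      rw [h, ← tw_formMul]
      congr 1
      apply Subtype.ext
      change form _ * KMW.map _ _ = KMW.map _ (form u * α.1)
      rw [map_mul, map_form])

end inclusion

section residue

variable (k : Type*) {F : Type*} [Field k] [Field F] [Algebra k F] [Algebra.EssFiniteType k F]

variable (F) in
/-- The element `e₁ ∧ ⋯ ∧ e_r ∧ dt` of `det Ω_{F(t)/k}`, where the `e_i` form a basis of the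
differentials of `F`: the image of a generator of the `F[t]`-module `det Ω_{F[t]/k}`. -/
noncomputable def genericGenerator : NonzeroVec (Det (RatFunc F) Ω[RatFunc F⁄k]) :=
  ⟨⟨ExteriorAlgebra.ιMulti (RatFunc F) _ (ratBasis (Module.finBasis F Ω[F⁄k])), by
    rw [finrank_ratFunc k]
    exact ExteriorAlgebra.ιMulti_range _ _ ⟨_, rfl⟩⟩,
    fun h => ιMulti_basis_ne_zero _ (congrArg Subtype.val h)⟩

/-- The image in `det (F(p) ⊗ Ω_{F[t]/k})` of the same generator of `det Ω_{F[t]/k}`. -/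
noncomputable def specialGenerator (p : MonicIrreducible F) :
    NonzeroVec (Det (ResidueField p) (ConormalTarget k p)) :=
  ⟨⟨ExteriorAlgebra.ιMulti (ResidueField p) _ (residueBasis k p), by
    rw [finrank_conormalTarget k p]
    exact ExteriorAlgebra.ιMulti_range _ _ ⟨_, rfl⟩⟩,
    fun h => ιMulti_basis_ne_zero _ (congrArg Subtype.val h)⟩

/-- `p̄^* ⊗ m̄`, where `p̄^*` is dual to the class of `p` and `m̄` is the element above. -/
noncomputable def targetGenerator (p : MonicIrreducible F) :
    NonzeroVec (LineDual (ResidueField p) (Conormal p) ⊗[ResidueField p]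
      Det (ResidueField p) (ConormalTarget k p)) :=
  ⟨dualVec (conormalBasis p) ⊗ₜ (specialGenerator k p).1,
    tmul_ne_zero_of_ne_zero (dualVec_ne_zero _) (specialGenerator k p).2⟩

/-- The residue `∂_p^p` in degree `n`. -/
noncomputable def residueHom (p : MonicIrreducible F) (n : ℤ) :
    deg (RatFunc F) n →+ deg (ResidueField p) (n - 1) where
  toFun α := ⟨KMW.residue (datum p) α.1, residue_mem _ α.2⟩
  map_zero' := Subtype.ext (map_zero _)
  map_add' _ _ := Subtype.ext (map_add _ _ _)

theorem finrank_genericDet :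
    Module.finrank (RatFunc F) (Det (RatFunc F) Ω[RatFunc F⁄k]) = 1 :=
  have := Module.Finite.of_basis (ratBasis (Module.finBasis F Ω[F⁄k]))
  finrank_det _ _

/-- `α ↦ ⟨c⟩ α`. -/
noncomputable def formMulHom {E : Type*} [Field E] (c : Eˣ) (n : ℤ) : deg E n →+ deg E n where
  toFun α := formMul c α
  map_zero' := Subtype.ext (mul_zero _)
  map_add' _ _ := Subtype.ext (mul_add _ _ _)

/-- The twisted residue at `p`, with values in the Milnor-Witt K-theory of `F(p)` twisted by
`(𝔪_p / 𝔪_p²)^* ⊗ det Ω_{F[t]/k}`: it maps `α ⊗ m` to `∂_p^p(α) ⊗ p̄^* ⊗ m̄` for a generator `m` of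
the lattice `det Ω_{F[t]/k}` (`twistedResidue_tw`), hence `α ⊗ (c m) = (⟨c⟩ α) ⊗ m` to
`∂_p^p(⟨c⟩ α) ⊗ p̄^* ⊗ m̄`.  Another generator over the local ring at `p` gives the same map, since
`∂_p^p(⟨u⟩ α) = ⟨ū⟩ ∂_p^p(α)` for units `u` (`residue_form_mul`). -/
noncomputable def twistedResidue (p : MonicIrreducible F) (n : ℤ) :
    Twisted (RatFunc F) (Det (RatFunc F) Ω[RatFunc F⁄k]) n →+
      Twisted (ResidueField p) (LineDual (ResidueField p) (Conormal p) ⊗[ResidueField p]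
        Det (ResidueField p) (ConormalTarget k p)) (n - 1) :=
  twLift
    (fun l => (twHom (targetGenerator k p)).comp ((residueHom p n).comp
      (formMulHom (ratio (finrank_genericDet k) (genericGenerator k F) l) n)))
    (fun u l α => by
      rw [ratio_units_smul]
      change tw _ _ = tw _ _
      congr 1
      apply Subtype.ext
      change KMW.residue _ (form _ * α.1) = KMW.residue _ (form _ * (form u * α.1))
      rw [mul_comm u, form_mul, mul_assoc])

theorem twistedResidue_tw (p : MonicIrreducible F) {n : ℤ} (α : deg (RatFunc F) n) :
    twistedResidue k p n (tw α (genericGenerator k F)) =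
      tw (residueHom p n α) (targetGenerator k p) := by
  rw [twistedResidue, twLift_tw, ratio_eq _ _ _ 1 (one_smul _ _)]
  change tw (residueHom p n (formMul 1 α)) _ = _
  congr 2
  exact Subtype.ext (by change form 1 * α.1 = α.1; rw [form_one, one_mul])

theorem finite_residueDifferentials (p : MonicIrreducible F) :
    Module.Finite (ResidueField p) Ω[ResidueField p⁄k] :=
  have := Module.Finite.of_basis (residueBasis k p)
  Module.Finite.of_surjective (mapBaseChange k F[X] (ResidueField p))
    (mapBaseChange_surjective k F[X] (ResidueField p) Ideal.Quotient.mk_surjective)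

variable [PerfectField k]

theorem exists_section (p : MonicIrreducible F) :
    ∃ s : Ω[ResidueField p⁄k] →ₗ[ResidueField p] ConormalTarget k p,
      mapBaseChange k F[X] (ResidueField p) ∘ₗ s = LinearMap.id :=
  LinearMap.exists_rightInverse_of_surjective _ (LinearMap.range_eq_top.mpr
    (mapBaseChange_surjective k F[X] (ResidueField p) Ideal.Quotient.mk_surjective))

/-- The canonical isomorphism
`D(Ω_{F(p)/k}) ≅ ((𝔪_p / 𝔪_p²)^*, -1) ⊗ (F(p) ⊗ D(Ω_{F[t]/k}))` given by the exact sequence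
`0 → 𝔪_p / 𝔪_p² → F(p) ⊗ Ω_{F[t]/k} → Ω_{F(p)/k} → 0`. -/
noncomputable def canonicalIso (p : MonicIrreducible F) :
    Det (ResidueField p) Ω[ResidueField p⁄k] ≃ₗ[ResidueField p]
      LineDual (ResidueField p) (Conormal p) ⊗[ResidueField p]
        Det (ResidueField p) (ConormalTarget k p) :=
  LinearEquiv.ofBijective
    (coDet (conormalMap k p) (exists_section k p).choose (finrank_residueField k p)
      (conormalBasis p))
    (have := Module.Finite.of_basis (residueBasis k p)
     have := finite_residueDifferentials k p
     coDet_bijective (finrank_residueField k p) (conormalMap_injective k p)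
      (mapBaseChange_conormalMap k p) (exists_section k p).choose_spec (conormalBasis p))

/-- The twisted residue at `p`, with values in the Milnor-Witt K-theory of `F(p)` twisted by
`det Ω_{F(p)/k}`. -/
noncomputable def residueAt (p : MonicIrreducible F) (n : ℤ) :
    Twisted (RatFunc F) (Det (RatFunc F) Ω[RatFunc F⁄k]) n →+
      Twisted (ResidueField p) (Det (ResidueField p) Ω[ResidueField p⁄k]) (n - 1) :=
  (twCongr (canonicalIso k p).symm (n - 1)).comp (twistedResidue k p n)

theorem finite_dvd {x : F[X]} (hx : x ≠ 0) : {p : MonicIrreducible F | p.1 ∣ x}.Finite := by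
  classical
  refine Set.Finite.of_finite_image (f := Subtype.val)
    ((UniqueFactorizationMonoid.normalizedFactors x).toFinset.finite_toSet.subset ?_)
    Subtype.val_injective.injOn
  rintro _ ⟨p, hp, rfl⟩
  rw [Finset.mem_coe, Multiset.mem_toFinset, Polynomial.mem_normalizedFactors_iff hx]
  exact ⟨p.2.2, p.2.1, hp⟩

theorem finite_ord_ne_zero (a : (RatFunc F)ˣ) :
    {p : MonicIrreducible F | (datum p).ord a ≠ 0}.Finite := by
  obtain ⟨x, y, hy, e⟩ := IsFractionRing.div_surjective (A := F[X]) (a : RatFunc F)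
  have hy0 : y ≠ 0 := nonZeroDivisors.ne_zero hy
  have hx0 : x ≠ 0 := by
    rintro rfl
    exact a.ne_zero (by rw [← e, map_zero, zero_div])
  refine ((finite_dvd hx0).union (finite_dvd hy0)).subset fun p hp => ?_
  by_contra hcon
  rw [Set.mem_union, not_or] at hcon
  refine hp (ResidueDatum.IsRep.ord_eq (x := x) (y := y) ⟨hcon.1, hcon.2, ?_⟩)
  have hy1 : algebraMap F[X] (RatFunc F) y ≠ 0 := by
    simpa using hy0
  rw [← e, zpow_zero, one_mul, div_mul_cancel₀ _ hy1]

theorem finite_residue_ne_zero (α : KMW (RatFunc F)) :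
    {p : MonicIrreducible F | KMW.residue (datum p) α ≠ 0}.Finite := by
  induction α using KMW.induction with
  | hz n =>
    refine Set.finite_empty.subset fun p hp => hp ?_
    change residueMatrix _ _ _ _ = 0
    rw [map_intCast, ← zsmul_one]
    simp
  | hs a =>
    refine (finite_ord_ne_zero a).subset fun p hp h => hp ?_
    change residueMatrix _ _ _ _ = 0
    rw [residueMatrix_sym, h, symMatrix_zero]
    simp
  | he =>
    refine Set.finite_empty.subset fun p hp => hp ?_
    change residueMatrix _ _ _ _ = 0
    rw [residueMatrix_eta]
    simp [etaMatrix]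
  | hadd x y hx hy =>
    refine (hx.union hy).subset fun p hp => ?_
    by_contra hcon
    simp only [Set.mem_union, Set.mem_ofPred_eq, not_or, not_not] at hcon
    exact hp (by rw [map_add, hcon.1, hcon.2, add_zero])
  | hmul x y hx hy =>
    refine (hx.union hy).subset fun p hp => ?_
    by_contra hcon
    simp only [Set.mem_union, Set.mem_ofPred_eq, not_or, not_not] at hcon
    exact hp (by rw [residue_mul, hcon.1, hcon.2, zero_mul, mul_zero, add_zero])

theorem finite_residueAt_ne_zero {n : ℤ}
    (x : Twisted (RatFunc F) (Det (RatFunc F) Ω[RatFunc F⁄k]) n) :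
    {p : MonicIrreducible F | residueAt k p n x ≠ 0}.Finite := by
  induction x using twisted_induction with
  | h0 => exact Set.finite_empty.subset fun p hp => hp (map_zero _)
  | hadd x y hx hy =>
    refine (hx.union hy).subset fun p hp => ?_
    by_contra hcon
    simp only [Set.mem_union, Set.mem_ofPred_eq, not_or, not_not] at hcon
    exact hp (by rw [map_add, hcon.1, hcon.2, add_zero])
  | ht α l =>
    refine (finite_residue_ne_zero (form (ratio (finrank_genericDet k)
      (genericGenerator k F) l) * α.1)).subset fun p hp h => hp ?_
    have h' : residueHom p n (formMul (ratio (finrank_genericDet k)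
      (genericGenerator k F) l) α) = 0 := Subtype.ext h
    have h2 : twistedResidue k p n (tw α l) = 0 := by
      rw [twistedResidue, twLift_tw]
      change twHom _ (residueHom p n (formMul _ α)) = 0
      rw [h', map_zero]
    rw [residueAt, AddMonoidHom.comp_apply, h2, map_zero]

variable (F) in
/-- The total residue homomorphism, whose component at `p` is `residueAt k p n`. -/
noncomputable def totalResidue (n : ℤ) :
    Twisted (RatFunc F) (Det (RatFunc F) Ω[RatFunc F⁄k]) n →+
      DirectSum (MonicIrreducible F) fun p =>
        Twisted (ResidueField p) (Det (ResidueField p) Ω[ResidueField p⁄k]) (n - 1) :=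
  toDirectSum (fun p => residueAt k p n) (finite_residueAt_ne_zero k)

theorem totalResidue_apply {n : ℤ}
    (x : Twisted (RatFunc F) (Det (RatFunc F) Ω[RatFunc F⁄k]) n) (p : MonicIrreducible F) :
    totalResidue k F n x p = residueAt k p n x := by
  rw [totalResidue, toDirectSum_apply]

end residue
end MW

/-! A nonzero vector of a line identifies a twisted group with the untwisted one
(`twHom_bijective`). With compatible vectors, the inclusion becomes base change and the residue at
`p` becomes the residue for the uniformizer `p` (`inclusion_baseEquiv`, `residueAt_genericEquiv`).
What remains is Milnor's argument for `K(t)`, carried out for untwisted Milnor–Witt K-theory.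

Let `L_d = polySubring F d`. The ring `L_1` is the image of the K-theory of `F`, the `L_d` exhaust
the K-theory of `F(t)`, and elements of `L_d` have no residue at primes of degree at least `d`. Two
facts control the passage from `L_d` to `L_{d+1}`, for `d > 0`.

Generation (`polySubring_succ_le`): `L_{d+1}` is contained in the sum of `L_d` and the groups `[p]
L_d` with `deg p = d`. The point is that a product `[p][q]` can be reduced by the Steinberg relation
for `p/(p-q) - q/(p-q) = 1`, in which `p - q` has degree less than `d`.

Injectivity (`sym_primeUnit_mul_mem`): for `x` in `L_d` and `deg p = d`, the residue of `[p]x` at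
`p` is the specialization of `x`, and if it vanishes then `[p]x` lies in `L_d`. Indeed the `x` with
`[p]x` in `L_d` form a two-sided ideal `I`. Sending the symbol of a unit of `F(p)` to the symbol of
its lift of degree less than `d` respects the Milnor–Witt relations modulo `I`. The resulting map
from the K-theory of `F(p)` to `L_d / I`, composed with specialization, is the quotient map. Only
the relation for `[ab]` uses `I`: if `fg = h + pq`, it follows from the Steinberg relation for
`h/(fg) + pq/(fg) = 1`.

Hence an element of `L_{d+1}` without residues in degree `d` lies in `L_d`, and an element without
any residue descends to `L_1`; this is exactness in the middle. For surjectivity, lift a class at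
`p` to some `x` in `L_{deg p}`: then `[p]x` has the prescribed residue at `p`, and its other
residues sit at primes of smaller degree, where induction removes them. Finally, specialization at
`t = 0` is a retraction of base change that preserves degrees; it gives injectivity and the
splitting. -/

namespace MW
namespace KMW

/-! ### Consequences of the Milnor–Witt relations. -/

section relations

variable {F : Type*} [Field F]

/-- Expand `[a][-a] = 0` with `[-a] = [-1] + ⟨-1⟩[a]`, then multiply by `⟨-1⟩`, which squares to `1`
and acts on `[-1]` as `-1`. -/
theorem sym_mul_self (a : Fˣ) : sym a * sym a = sym a * sym (-1) := by
  have h := sym_neg_self a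
  rw [neg_eq_neg_one_mul, sym_mul', mul_add, ← mul_assoc, ← (form_comm (-1) (sym a)).eq,
    mul_assoc] at h
  have h2 : form (-1 : Fˣ) * (sym a * sym (-1)) = - (sym a * sym (-1)) := by
    rw [← mul_assoc, (form_comm (-1) (sym a)).eq, mul_assoc, form_neg_one_mul_sym, mul_neg]
  have h3 := congrArg (form (-1 : Fˣ) * ·) h
  simp only [mul_add, mul_zero, h2] at h3
  rw [← mul_assoc (form (-1 : Fˣ)), form_neg_one_sq, one_mul] at h3
  exact (neg_add_eq_zero.mp h3).symm

/-- Since `[a][a] = [a][-1]`, the element `η[a²]` is `[a]` times the hyperbolic relation `η(η[-1] +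
2) = 0`. Each `⟨a⟩` is thus its own inverse, which is how forms are cancelled from relations below.
-/
theorem form_mul_self (a : Fˣ) : form a * form a = 1 := by
  rw [← form_mul, form, add_eq_left, sym_mul, mul_assoc, sym_mul_self]
  have h := eta_hyp (F := F)
  calc eta * (sym a + sym a + eta * (sym a * sym (-1)))
      = (eta * sym a) * 2 + eta * ((eta * sym a) * sym (-1)) := by noncomm_ring
    _ = sym a * (eta * (eta * sym (-1) + 2)) := by
        rw [eta_sym, ← mul_assoc eta (sym a * eta), ← mul_assoc eta (sym a), eta_sym]; noncomm_ring
    _ = 0 := by rw [h, mul_zero]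

theorem form_mul_form_mul (a : Fˣ) (x : KMW F) : form a * (form a * x) = x := by
  rw [← mul_assoc, form_mul_self, one_mul]

theorem sym_inv_eq (a : Fˣ) : sym a⁻¹ = - (form a * sym a) := by
  rw [sym_inv a, mul_neg, form_mul_form_mul, neg_neg]

/-- The symbols commute up to `ε`. -/
theorem sym_mul_sym (a b : Fˣ) : sym a * sym b = eps F * (sym b * sym a) := by
  have h := sym_neg_self (a * b)
  have hb : sym b * sym b = sym b * sym (-1) := sym_mul_self b
  have e1 : sym (-(a * b)) = sym (-a) + form (-a) * sym b := by rw [← neg_mul, sym_mul']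
  have e2 : sym (-a) = sym a + form a * sym (-1) := by rw [← mul_neg_one, sym_mul']
  have c : ∀ (c : Fˣ) (x y : KMW F), x * (form c * y) = form c * (x * y) := fun c x y => by
    rw [← mul_assoc, ← (form_comm c x).eq, mul_assoc]
  have hna : form (-a) = form (-1) * form a := by rw [← form_mul, neg_one_mul]
  have hb1 : form (-1 : Fˣ) * (sym b * sym (-1)) = - (sym b * sym (-1)) := by
    rw [← c, form_neg_one_mul_sym, mul_neg]
  -- This is the expansion of `[ab][-ab] = 0`: the term `[a][-a]` vanishes, and the two terms in
  -- `[b][-1]` cancel because `⟨a⟩⟨-a⟩[b][b] = ⟨-1⟩[b][-1] = -[b][-1]`.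
  have h1 : form (-a) * (sym a * sym b) + form a * (sym b * sym a) = 0 := by
    rw [e1, sym_mul', add_mul, mul_add, mul_add, sym_neg_self, zero_add, mul_assoc, mul_assoc, c, c,
      e2, mul_add, c, hb, hna, mul_assoc (form (-1)), mul_add (form a), form_mul_form_mul,
      mul_assoc (form (-1)), c (-1) (form a), form_mul_form_mul, hb1] at h
    rw [hna, mul_assoc, ← h]
    abel
  have h2 := congrArg (form (-a) * ·) h1
  simp only [mul_add, mul_zero, form_mul_form_mul] at h2
  rw [hna, mul_assoc, form_mul_form_mul] at h2
  rw [eps, neg_mul]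
  exact eq_neg_of_add_eq_zero_left h2

variable {E : Type*} [Field E]

theorem ringHom_ext {R : Type*} [Ring R] {f g : KMW F →+* R} (hs : ∀ a, f (sym a) = g (sym a))
    (he : f eta = g eta) (x : KMW F) : f x = g x := by
  induction x using KMW.induction with
  | hz n => simp
  | hs a => exact hs a
  | he => exact he
  | hadd x y hx hy => rw [map_add, map_add, hx, hy]
  | hmul x y hx hy => rw [map_mul, map_mul, hx, hy]

/-- A ring homomorphism that preserves the degrees of the generators preserves degrees. -/
theorem ringHom_mem_deg (f : KMW F →+* KMW E) (hs : ∀ a, f (sym a) ∈ degGroup E 1)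
    (he : f eta ∈ degGroup E (-1)) {n : ℤ} {x : KMW F} (hx : x ∈ deg F n) : f x ∈ deg E n := by
  refine gen_induction (P := fun n x => f x ∈ degGroup E n) ?_ ?_ ?_ ?_ ?_ ?_ (mem_deg.mp hx)
  · rw [map_one]; exact one_mem
  · intro n a x h
    rw [map_mul]; exact mul_mem (hs a) h
  · intro n x h
    rw [map_mul]; exact mul_mem he h
  · rw [map_zero]; exact zero_mem _
  · intro x y hx hy
    rw [map_add]; exact add_mem hx hy
  · intro x hx
    rw [map_neg]; exact neg_mem hx

end relations

/-! ### Specialization at a discrete valuation. -/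

section specialization

variable {A K κ : Type*} [CommRing A] [IsDomain A] [WfDvdMonoid A] [Field K]
    [Algebra A K] [IsFractionRing A K] [Field κ] (v : ResidueDatum A K κ)

/-- The specialization homomorphism `[π ^ n u] ↦ [ū]`, `η ↦ η`. -/
noncomputable def specialization : KMW K →+* KMW κ where
  toFun α := residueMatrix v α 0 0
  map_one' := by simp
  map_zero' := by simp
  map_add' := by simp
  -- The matrices are lower triangular, so a diagonal entry is multiplicative.
  map_mul' x y := by simp [Matrix.mul_apply, Fin.sum_univ_two, residueMatrix_upper]

theorem specialization_sym (a : Kˣ) : specialization v (sym a) = sym (v.lead a) := by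
  simp [specialization, residueMatrix_sym, symMatrix]

theorem specialization_eta : specialization v eta = eta := by
  simp [specialization, residueMatrix_eta, etaMatrix]

theorem specialization_mem {n : ℤ} {x : KMW K} (hx : x ∈ deg K n) :
    specialization v x ∈ deg κ n :=
  ringHom_mem_deg _ (fun a => by rw [specialization_sym]; exact sym_mem _)
    (by rw [specialization_eta]; exact eta_mem) hx

/-- The residue is a derivation twisted by two ring homomorphisms, the diagonal entries of
`residueMatrix`. It therefore vanishes on any subring on whose generators it vanishes. -/
theorem residue_mul_eq (α β : KMW K) : residue v (α * β) =
    residue v α * specialization v β + residueMatrix v α 1 1 * residue v β :=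
  residue_mul v α β

theorem residue_sym_of_ord_eq_zero (a : Kˣ) (ha : v.ord a = 0) : residue v (sym a) = 0 := by
  simpa using residue_units v [a] (by simpa using ha)

theorem residue_sym_unif (t : Kˣ) (ht : (t : K) = algebraMap A K v.unif) :
    residue v (sym t) = 1 := by
  simpa using residue_unif_units v t ht [] (by simp)

theorem residue_eta : residue v eta = 0 := by
  simp [residue, residueMatrix_eta, etaMatrix]

theorem residue_intCast (n : ℤ) : residue v n = 0 := by
  change residueMatrix _ _ _ _ = 0
  rw [map_intCast, ← zsmul_one]
  simp

end specialization

end KMW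
end MW

namespace MW
open Polynomial KMW

/-! ### The filtration of the K-theory of `F(t)` by degree. -/

section filtration

variable (F : Type*) [Field F]

/-- The subring of the Milnor-Witt K-theory of `F(t)` generated by `η` and the symbols of the
polynomials of degree less than `d`. -/
noncomputable def polySubring (d : ℕ) : Subring (KMW (RatFunc F)) :=
  Subring.closure ({eta} ∪ {x | ∃ (u : (RatFunc F)ˣ) (f : F[X]), f.natDegree < d ∧
    (u : RatFunc F) = algebraMap F[X] (RatFunc F) f ∧ sym u = x})

variable {F} {d : ℕ}

theorem eta_mem_polySubring : eta ∈ polySubring F d :=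
  Subring.subset_closure (Or.inl rfl)

theorem sym_mem_polySubring (u : (RatFunc F)ˣ) (f : F[X]) (hf : f.natDegree < d)
    (hu : (u : RatFunc F) = algebraMap F[X] (RatFunc F) f) : sym u ∈ polySubring F d :=
  Subring.subset_closure (Or.inr ⟨u, f, hf, hu, rfl⟩)

theorem form_mem_polySubring {u : (RatFunc F)ˣ} (hu : sym u ∈ polySubring F d) :
    form u ∈ polySubring F d :=
  Subring.add_mem _ (Subring.one_mem _) (Subring.mul_mem _ eta_mem_polySubring hu)

/-- The units whose symbol lies in the subring are closed under products and, by the next two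
lemmas, under inverses and quotients. So quotients of polynomials of small degree may be used in
Steinberg relations. -/
theorem sym_mul_mem_polySubring {u w : (RatFunc F)ˣ} (hu : sym u ∈ polySubring F d)
    (hw : sym w ∈ polySubring F d) : sym (u * w) ∈ polySubring F d := by
  rw [sym_mul']
  exact Subring.add_mem _ hu (Subring.mul_mem _ (form_mem_polySubring hu) hw)

theorem sym_inv_mem_polySubring {u : (RatFunc F)ˣ} (hu : sym u ∈ polySubring F d) :
    sym u⁻¹ ∈ polySubring F d := by
  rw [sym_inv_eq]
  exact Subring.neg_mem _ (Subring.mul_mem _ (form_mem_polySubring hu) hu)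

theorem sym_div_mem_polySubring {u w : (RatFunc F)ˣ} (hu : sym u ∈ polySubring F d)
    (hw : sym w ∈ polySubring F d) : sym (u / w) ∈ polySubring F d := by
  rw [div_eq_mul_inv]
  exact sym_mul_mem_polySubring hu (sym_inv_mem_polySubring hw)

theorem sym_neg_one_mem_polySubring (hd : 0 < d) : sym (-1) ∈ polySubring F d :=
  sym_mem_polySubring _ (-1) (by simpa using hd) (by simp)

theorem eps_mem_polySubring (hd : 0 < d) : eps (RatFunc F) ∈ polySubring F d :=
  Subring.neg_mem _ (form_mem_polySubring (sym_neg_one_mem_polySubring hd))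

theorem polySubring_mono {e : ℕ} (h : d ≤ e) : polySubring F d ≤ polySubring F e := by
  refine Subring.closure_mono (Set.union_subset_union_right _ ?_)
  rintro _ ⟨u, f, hf, hu, rfl⟩
  exact ⟨u, f, hf.trans_le h, hu, rfl⟩

/-- Symbols move to the left past elements of the subring. -/
theorem exists_mul_sym_eq (hd : 0 < d) (a : (RatFunc F)ˣ) {x : KMW (RatFunc F)}
    (hx : x ∈ polySubring F d) : ∃ y ∈ polySubring F d, x * sym a = sym a * y := by
  induction hx using Subring.closure_induction with
  | mem x hx =>
    obtain rfl | ⟨u, f, hf, hu, rfl⟩ := hx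
    · exact ⟨eta, eta_mem_polySubring, eta_sym a⟩
    · refine ⟨eps _ * sym u, Subring.mul_mem _ (eps_mem_polySubring hd)
        (sym_mem_polySubring u f hf hu), ?_⟩
      rw [sym_mul_sym, ← mul_assoc, (eps_comm (sym a)).eq, mul_assoc]
  | zero => exact ⟨0, Subring.zero_mem _, by simp⟩
  | one => exact ⟨1, Subring.one_mem _, by simp⟩
  | add x y _ _ hx hy =>
    obtain ⟨x', hx', ex⟩ := hx
    obtain ⟨y', hy', ey⟩ := hy
    exact ⟨x' + y', Subring.add_mem _ hx' hy', by rw [add_mul, mul_add, ex, ey]⟩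
  | neg x _ hx =>
    obtain ⟨x', hx', ex⟩ := hx
    exact ⟨-x', Subring.neg_mem _ hx', by rw [neg_mul, mul_neg, ex]⟩
  | mul x y _ _ hx hy =>
    obtain ⟨x', hx', ex⟩ := hx
    obtain ⟨y', hy', ey⟩ := hy
    exact ⟨x' * y', Subring.mul_mem _ hx' hy', by rw [mul_assoc, ey, ← mul_assoc, ex, mul_assoc]⟩

/-- Symbols move to the right past elements of the subring. -/
theorem exists_sym_mul_eq (hd : 0 < d) (a : (RatFunc F)ˣ) {x : KMW (RatFunc F)}
    (hx : x ∈ polySubring F d) : ∃ y ∈ polySubring F d, sym a * x = y * sym a := by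
  induction hx using Subring.closure_induction with
  | mem x hx =>
    obtain rfl | ⟨u, f, hf, hu, rfl⟩ := hx
    · exact ⟨eta, eta_mem_polySubring, (eta_sym a).symm⟩
    · refine ⟨eps _ * sym u, Subring.mul_mem _ (eps_mem_polySubring hd)
        (sym_mem_polySubring u f hf hu), ?_⟩
      rw [sym_mul_sym, mul_assoc]
  | zero => exact ⟨0, Subring.zero_mem _, by simp⟩
  | one => exact ⟨1, Subring.one_mem _, by simp⟩
  | add x y _ _ hx hy =>
    obtain ⟨x', hx', ex⟩ := hx
    obtain ⟨y', hy', ey⟩ := hy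
    exact ⟨x' + y', Subring.add_mem _ hx' hy', by rw [add_mul, mul_add, ex, ey]⟩
  | neg x _ hx =>
    obtain ⟨x', hx', ex⟩ := hx
    exact ⟨-x', Subring.neg_mem _ hx', by rw [neg_mul, mul_neg, ex]⟩
  | mul x y _ _ hx hy =>
    obtain ⟨x', hx', ex⟩ := hx
    obtain ⟨y', hy', ey⟩ := hy
    exact ⟨x' * y', Subring.mul_mem _ hx' hy', by rw [← mul_assoc, ex, mul_assoc, ey, mul_assoc]⟩

/-- The degree bound is strict, so at index `1` only nonzero constants contribute symbols: the
filtration starts at the image of the K-theory of `F`. -/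
theorem mem_polySubring_one {x : KMW (RatFunc F)} (hx : x ∈ polySubring F 1) :
    ∃ y : KMW F, KMW.map (algebraMap F (RatFunc F)) y = x := by
  refine (Subring.closure_le (t := (KMW.map (algebraMap F (RatFunc F))).range)).mpr ?_ hx
  rintro _ (rfl | ⟨u, f, hf, hu, rfl⟩)
  · exact ⟨eta, map_eta _⟩
  · obtain ⟨c, rfl⟩ := Polynomial.natDegree_eq_zero.mp (Nat.lt_one_iff.mp hf)
    have hc : c ≠ 0 := by
      rintro rfl
      exact u.ne_zero (by rw [hu]; simp)
    refine ⟨sym (Units.mk0 c hc), ?_⟩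
    rw [map_sym]
    congr 1
    ext
    rw [hu]
    rfl

/-- The filtration is exhaustive, because a rational function is a quotient of two polynomials. -/
theorem exists_mem_polySubring (x : KMW (RatFunc F)) : ∃ d, x ∈ polySubring F d := by
  have hadd : ∀ {x y : KMW (RatFunc F)}, (∃ d, x ∈ polySubring F d) →
      (∃ d, y ∈ polySubring F d) → ∃ d, x ∈ polySubring F d ∧ y ∈ polySubring F d := by
    rintro x y ⟨d, hx⟩ ⟨e, hy⟩
    exact ⟨max d e, polySubring_mono (le_max_left _ _) hx, polySubring_mono (le_max_right _ _) hy⟩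
  induction x using KMW.induction with
  | hz n => exact ⟨0, intCast_mem _ n⟩
  | he => exact ⟨0, eta_mem_polySubring⟩
  | hs a =>
    obtain ⟨x, y, hy, e⟩ := IsFractionRing.div_surjective (A := F[X]) (a : RatFunc F)
    have hy1 : algebraMap F[X] (RatFunc F) y ≠ 0 := by
      simpa using nonZeroDivisors.ne_zero hy
    have hx1 : algebraMap F[X] (RatFunc F) x ≠ 0 := by
      intro h
      exact a.ne_zero (by rw [← e, h, zero_div])
    have ea : a = Units.mk0 _ hx1 / Units.mk0 _ hy1 := by
      ext; simp [e]
    obtain ⟨d, h1, h2⟩ := hadd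
      ⟨_, sym_mem_polySubring (Units.mk0 _ hx1) x (Nat.lt_succ_self _) rfl⟩
      ⟨_, sym_mem_polySubring (Units.mk0 _ hy1) y (Nat.lt_succ_self _) rfl⟩
    exact ⟨d, ea ▸ sym_div_mem_polySubring h1 h2⟩
  | hadd x y hx hy =>
    obtain ⟨d, h1, h2⟩ := hadd hx hy
    exact ⟨d, Subring.add_mem _ h1 h2⟩
  | hmul x y hx hy =>
    obtain ⟨d, h1, h2⟩ := hadd hx hy
    exact ⟨d, Subring.mul_mem _ h1 h2⟩

end filtration

/-! ### Residues on the filtration. -/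

section prime

variable {F : Type*} [Field F] (p : MonicIrreducible F)

/-- The polynomial `p` as a unit of `F(t)`. -/
noncomputable def primeUnit : (RatFunc F)ˣ :=
  Units.mk0 (algebraMap F[X] (RatFunc F) p.1) (by simpa using p.2.2.ne_zero)

theorem natDegree_pos : 0 < p.1.natDegree := p.2.2.natDegree_pos

theorem not_dvd_of_natDegree_lt {f : F[X]} (hf : f ≠ 0) (hd : f.natDegree < p.1.natDegree) :
    ¬ p.1 ∣ f := fun h => (Polynomial.natDegree_le_of_dvd h hf).not_gt hd

theorem ord_lead_of_poly {u : (RatFunc F)ˣ} {f : F[X]} (hf : ¬ p.1 ∣ f)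
    (hu : (u : RatFunc F) = algebraMap F[X] (RatFunc F) f) :
    (datum p).ord u = 0 ∧ ((datum p).lead u : ResidueField p) = Ideal.Quotient.mk _ f := by
  have h := (datum p).isRep_of_not_dvd hf u hu
  refine ⟨h.ord_eq, ?_⟩
  rw [h.lead_eq, map_one, div_one]
  rfl

theorem ne_zero_of_unit {u : (RatFunc F)ˣ} {f : F[X]}
    (hu : (u : RatFunc F) = algebraMap F[X] (RatFunc F) f) : f ≠ 0 := by
  rintro rfl
  exact u.ne_zero (by rw [hu]; simp)

/-- A nonzero polynomial of degree less than that of `p` is a unit at `p`, so the generators have no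
residue; the twisted derivation rule passes this on to products. -/
theorem residue_eq_zero_of_mem {d : ℕ} (hd : d ≤ p.1.natDegree) {x : KMW (RatFunc F)}
    (hx : x ∈ polySubring F d) : KMW.residue (datum p) x = 0 := by
  induction hx using Subring.closure_induction with
  | mem x hx =>
    obtain rfl | ⟨u, f, hf, hu, rfl⟩ := hx
    · exact residue_eta _
    · exact residue_sym_of_ord_eq_zero _ _
        (ord_lead_of_poly p (not_dvd_of_natDegree_lt p (ne_zero_of_unit hu) (hf.trans_le hd)) hu).1
  | zero => exact map_zero _
  | one => simpa using residue_intCast (datum p) (K := RatFunc F) 1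
  | add x y _ _ hx hy => rw [map_add, hx, hy, add_zero]
  | neg x _ hx => rw [map_neg, hx, neg_zero]
  | mul x y _ _ hx hy => rw [residue_mul, hx, hy, zero_mul, mul_zero, add_zero]

end prime
end MW

namespace MW
open Polynomial KMW

/-! ### The kernel of specialization on the filtration. -/

section kernel

variable {F : Type*} [Field F] (p : MonicIrreducible F)

/-- Every unit of `F(p)` lifts to a polynomial of degree less than that of `p`. -/
theorem exists_reduced (a : (ResidueField p)ˣ) : ∃ t : (RatFunc F)ˣ × F[X],
    t.2.natDegree < p.1.natDegree ∧ (t.1 : RatFunc F) = algebraMap F[X] (RatFunc F) t.2 ∧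
      Ideal.Quotient.mk (Ideal.span {p.1}) t.2 = a := by
  obtain ⟨f, hf⟩ := Ideal.Quotient.mk_surjective (I := Ideal.span {p.1}) (a : ResidueField p)
  have hm : Ideal.Quotient.mk (Ideal.span {p.1}) (f %ₘ p.1) = a := by
    rw [← hf, Ideal.Quotient.eq, Ideal.mem_span_singleton]
    exact ⟨-(f /ₘ p.1), by linear_combination Polynomial.modByMonic_add_div f p.1⟩
  have h0 : algebraMap F[X] (RatFunc F) (f %ₘ p.1) ≠ 0 := by
    intro h
    have h' : f %ₘ p.1 = 0 := by simpa using h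
    rw [h', map_zero] at hm
    exact a.ne_zero hm.symm
  exact ⟨(Units.mk0 _ h0, f %ₘ p.1), Polynomial.natDegree_modByMonic_lt f p.2.1
    (fun h => p.2.2.not_isUnit (by rw [h]; exact isUnit_one)), rfl, hm⟩

/-- The unit of `F(t)` given by the reduced polynomial that lifts `a`. -/
noncomputable def reducedUnit (a : (ResidueField p)ˣ) : (RatFunc F)ˣ := (exists_reduced p a).choose.1

/-- The reduced polynomial that lifts `a`. -/
noncomputable def reducedPoly (a : (ResidueField p)ˣ) : F[X] := (exists_reduced p a).choose.2

theorem natDegree_reducedPoly (a : (ResidueField p)ˣ) :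
    (reducedPoly p a).natDegree < p.1.natDegree := (exists_reduced p a).choose_spec.1

theorem reducedUnit_eq (a : (ResidueField p)ˣ) :
    (reducedUnit p a : RatFunc F) = algebraMap F[X] (RatFunc F) (reducedPoly p a) :=
  (exists_reduced p a).choose_spec.2.1

theorem mk_reducedPoly (a : (ResidueField p)ˣ) :
    Ideal.Quotient.mk (Ideal.span {p.1}) (reducedPoly p a) = a :=
  (exists_reduced p a).choose_spec.2.2

theorem reduced_unique {f g : F[X]} (hf : f.natDegree < p.1.natDegree)
    (hg : g.natDegree < p.1.natDegree)
    (h : Ideal.Quotient.mk (Ideal.span {p.1}) f = Ideal.Quotient.mk (Ideal.span {p.1}) g) :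
    f = g := by
  rw [Ideal.Quotient.eq, Ideal.mem_span_singleton] at h
  by_contra hne
  exact not_dvd_of_natDegree_lt p (sub_ne_zero.mpr hne)
    ((Polynomial.natDegree_sub_le f g).trans_lt (max_lt hf hg)) h

theorem reducedUnit_unique {u : (RatFunc F)ˣ} {f : F[X]} (hf : f.natDegree < p.1.natDegree)
    (hu : (u : RatFunc F) = algebraMap F[X] (RatFunc F) f) (a : (ResidueField p)ˣ)
    (ha : Ideal.Quotient.mk (Ideal.span {p.1}) f = a) : reducedUnit p a = u := by
  ext
  rw [hu, reducedUnit_eq, reduced_unique p (natDegree_reducedPoly p a) hf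
    ((mk_reducedPoly p a).trans ha.symm)]

theorem sym_reducedUnit_mem (a : (ResidueField p)ˣ) :
    sym (reducedUnit p a) ∈ polySubring F p.1.natDegree :=
  sym_mem_polySubring _ _ (natDegree_reducedPoly p a) (reducedUnit_eq p a)

/-- The elements `x` of the subring for which `[p] x` is in the subring as well. -/
noncomputable def primeIdeal : TwoSidedIdeal (polySubring F p.1.natDegree) :=
  TwoSidedIdeal.mk' {x | sym (primeUnit p) * (x : KMW (RatFunc F)) ∈ polySubring F p.1.natDegree}
    (by
      change sym (primeUnit p) * ((0 : polySubring F p.1.natDegree) : KMW (RatFunc F)) ∈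
        polySubring F p.1.natDegree
      rw [Subring.coe_zero, mul_zero]; exact Subring.zero_mem _)
    (fun {x y} hx hy => by
      change sym (primeUnit p) * ((x + y : polySubring F p.1.natDegree) : KMW (RatFunc F)) ∈
        polySubring F p.1.natDegree
      rw [Subring.coe_add, mul_add]; exact Subring.add_mem _ hx hy)
    (fun {x} hx => by
      change sym (primeUnit p) * ((-x : polySubring F p.1.natDegree) : KMW (RatFunc F)) ∈
        polySubring F p.1.natDegree
      rw [Subring.coe_neg, mul_neg]; exact Subring.neg_mem _ hx)
    (fun {x y} hy => by
      change sym (primeUnit p) * ((x * y : polySubring F p.1.natDegree) : KMW (RatFunc F)) ∈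
        polySubring F p.1.natDegree
      -- Only stability under left multiplication needs an argument: `[p]xy = x'[p]y` with `x'`
      -- again in the subring.
      obtain ⟨x', hx', e⟩ := exists_sym_mul_eq (natDegree_pos p) (primeUnit p) x.2
      rw [Subring.coe_mul, ← mul_assoc, e, mul_assoc]
      exact Subring.mul_mem _ hx' hy)
    (fun {x y} hx => by
      change sym (primeUnit p) * ((x * y : polySubring F p.1.natDegree) : KMW (RatFunc F)) ∈
        polySubring F p.1.natDegree
      rw [Subring.coe_mul, ← mul_assoc]
      exact Subring.mul_mem _ hx y.2)

theorem mem_primeIdeal {x : polySubring F p.1.natDegree} : x ∈ primeIdeal p ↔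
    sym (primeUnit p) * (x : KMW (RatFunc F)) ∈ polySubring F p.1.natDegree :=
  TwoSidedIdeal.mem_mk' _ _ _ _ _ _ _

/-- If `z = u w` modulo `p`, then `[z] - [u w]` is in the ideal. -/
theorem sym_mul_sym_sub_mem {u w z : (RatFunc F)ˣ} {f g h : F[X]}
    (hu : (u : RatFunc F) = algebraMap F[X] (RatFunc F) f)
    (hw : (w : RatFunc F) = algebraMap F[X] (RatFunc F) g)
    (hz : (z : RatFunc F) = algebraMap F[X] (RatFunc F) h)
    (hf : f.natDegree < p.1.natDegree) (hg : g.natDegree < p.1.natDegree)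
    (hh : h.natDegree < p.1.natDegree) (hdvd : p.1 ∣ f * g - h) :
    sym (primeUnit p) * (sym z - sym (u * w)) ∈ polySubring F p.1.natDegree := by
  obtain ⟨q, hq⟩ := hdvd
  by_cases hq0 : q = 0
  · have : z = u * w := by
      ext
      rw [Units.val_mul, hu, hw, hz, ← map_mul, sub_eq_zero.mp (hq.trans (by rw [hq0, mul_zero]))]
    rw [this, sub_self, mul_zero]
    exact Subring.zero_mem _
  -- From `pq = fg - h`, either `deg p + deg q ≤ deg f + deg g` or `deg p + deg q ≤ deg h`, with all
  -- of `f`, `g`, `h` of degree less than `deg p`.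
  have hqd : q.natDegree < p.1.natDegree := by
    have h1 : (p.1 * q).natDegree ≤ max (f.natDegree + g.natDegree) h.natDegree := by
      rw [← hq]
      exact (Polynomial.natDegree_sub_le _ _).trans
        (max_le_max_right _ Polynomial.natDegree_mul_le)
    rw [Polynomial.natDegree_mul p.2.2.ne_zero hq0] at h1
    omega
  have hqK : algebraMap F[X] (RatFunc F) q ≠ 0 := by simpa using hq0
  set v : (RatFunc F)ˣ := Units.mk0 _ hqK
  have su := sym_mem_polySubring u f hf hu
  have sw := sym_mem_polySubring w g hg hw
  have sz := sym_mem_polySubring z h hh hz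
  have sv := sym_mem_polySubring v q hqd rfl
  have suw := sym_mul_mem_polySubring su sw
  set a := z / (u * w)
  set b := v / (u * w)
  have sa : sym a ∈ polySubring F p.1.natDegree := sym_div_mem_polySubring sz suw
  have sb : sym b ∈ polySubring F p.1.natDegree := sym_div_mem_polySubring sv suw
  -- Dividing `fg = h + pq` by `fg` gives `a + bp = 1` with `a = h/(fg)` and `b = q/(fg)`, whose
  -- symbols lie in the subring.
  have st : sym (b * primeUnit p) * sym a = 0 := by
    refine steinberg ?_
    have hu0 := u.ne_zero
    have hw0 := w.ne_zero
    have e := congrArg (algebraMap F[X] (RatFunc F)) hq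
    rw [map_sub, map_mul, map_mul, ← hu, ← hw, ← hz] at e
    simp only [a, b, v, primeUnit, Units.val_mul, Units.val_div_eq_div_val, Units.val_mk0]
    field_simp
    linear_combination -e
  -- Expanding `[bp] = [b] + ⟨b⟩[p]` and cancelling `⟨b⟩` expresses `[p][a]` without `[p]`. It then
  -- suffices that `[z] - [uw]` is a multiple of `[a]`, which holds as `z = uwa`.
  have key : sym (primeUnit p) * sym a = - (form b * (sym b * sym a)) := by
    rw [sym_mul', add_mul, mul_assoc] at st
    have := congrArg (form b * ·) st
    simp only [mul_add, form_mul_form_mul, mul_zero] at this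
    exact eq_neg_of_add_eq_zero_right this
  have e : sym z - sym (u * w) = sym a * form (u * w) := by
    have : z = (u * w) * a := by simp [a]
    rw [this, sym_mul', add_sub_cancel_left, (form_comm _ _).eq]
  rw [e, ← mul_assoc, key]
  exact Subring.mul_mem _ (Subring.neg_mem _ (Subring.mul_mem _ (form_mem_polySubring sb)
    (Subring.mul_mem _ sb sa))) (form_mem_polySubring suw)

/-- The class of an element of the subring modulo the ideal. -/
noncomputable def quotMk : polySubring F p.1.natDegree →+* (primeIdeal p).ringCon.Quotient :=
  (primeIdeal p).ringCon.mk'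

theorem quotMk_eq_iff {x y : polySubring F p.1.natDegree} : quotMk p x = quotMk p y ↔
    sym (primeUnit p) * ((x : KMW (RatFunc F)) - y) ∈ polySubring F p.1.natDegree := by
  have h := TwoSidedIdeal.rel_iff (primeIdeal p) x y
  rw [mem_primeIdeal, AddSubgroupClass.coe_sub] at h
  exact (RingCon.eq _).trans h

/-- The class of `[u]`, for `u` the reduced polynomial that lifts `a`. -/
noncomputable def quotSym (a : (ResidueField p)ˣ) : (primeIdeal p).ringCon.Quotient :=
  quotMk p ⟨sym (reducedUnit p a), sym_reducedUnit_mem p a⟩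

/-- The class of `η`. -/
noncomputable def quotEta : (primeIdeal p).ringCon.Quotient :=
  quotMk p ⟨KMW.eta, eta_mem_polySubring⟩

theorem reducedUnit_neg_one : reducedUnit p (-1) = -1 :=
  reducedUnit_unique p (f := -1) (by simpa using natDegree_pos p) (by simp) _ (by simp)

/-- `[ū] ↦ [u]`, the inverse of the specialization modulo the ideal. -/
noncomputable def fromResidueField :
    KMW (ResidueField p) →+* (primeIdeal p).ringCon.Quotient :=
  KMW.lift (quotSym p) (quotEta p)
    (by
      intro a b h
      rw [quotSym, quotSym, ← map_mul, ← map_zero (quotMk p)]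
      congr 1
      -- The reduced lifts of `a` and `b` add up to a polynomial of degree less than that of `p`
      -- congruent to `1`, hence to `1` itself: this relation holds already in the subring.
      refine Subtype.ext (steinberg ?_)
      rw [reducedUnit_eq, reducedUnit_eq, ← map_add, ← map_one (algebraMap F[X] (RatFunc F))]
      congr 1
      refine reduced_unique p ((Polynomial.natDegree_add_le _ _).trans_lt
        (max_lt (natDegree_reducedPoly p a) (natDegree_reducedPoly p b)))
        (by simpa using natDegree_pos p) ?_
      rw [map_add, mk_reducedPoly, mk_reducedPoly, h, map_one])
    (by
      intro a b
      simp only [quotSym, quotEta, ← map_mul, ← map_add]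
      -- The lift of `ab` is only congruent to the product of the lifts, so this relation holds
      -- modulo the ideal.
      rw [quotMk_eq_iff]
      change _ * (_ - (sym _ + sym _ + KMW.eta * sym _ * sym _)) ∈ _
      rw [← sym_mul]
      refine sym_mul_sym_sub_mem p (reducedUnit_eq p a) (reducedUnit_eq p b)
        (reducedUnit_eq p (a * b)) (natDegree_reducedPoly p a) (natDegree_reducedPoly p b)
        (natDegree_reducedPoly p (a * b)) ?_
      rw [← Ideal.mem_span_singleton, ← Ideal.Quotient.eq, map_mul, mk_reducedPoly,
        mk_reducedPoly, mk_reducedPoly, Units.val_mul])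
    (by
      intro a
      rw [quotSym, quotEta, ← map_mul, ← map_mul]
      congr 1
      exact Subtype.ext (eta_sym _))
    (by
      have : (2 : (primeIdeal p).ringCon.Quotient) = quotMk p 2 := (map_ofNat (quotMk p) 2).symm
      rw [quotSym, quotEta, this, ← map_mul, ← map_add, ← map_mul, ← map_zero (quotMk p)]
      congr 1
      refine Subtype.ext ?_
      change KMW.eta * (KMW.eta * sym (reducedUnit p (-1)) + 2) = 0
      rw [reducedUnit_neg_one]
      exact eta_hyp)

/-- It suffices to compare generators: a polynomial of degree less than that of `p` is the reduced
lift of its own class. As a consequence, the kernel of specialization on the subring is contained in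
`primeIdeal p`. -/
theorem fromResidueField_specialization {x : KMW (RatFunc F)}
    (hx : x ∈ polySubring F p.1.natDegree) :
    fromResidueField p (specialization (datum p) x) = quotMk p ⟨x, hx⟩ := by
  induction hx using Subring.closure_induction with
  | mem x hx =>
    obtain rfl | ⟨u, f, hf, hu, rfl⟩ := hx
    · rw [specialization_eta, fromResidueField, lift_eta]
      rfl
    · rw [specialization_sym, fromResidueField, lift_sym, quotSym]
      congr 3
      exact reducedUnit_unique p hf hu _
        (ord_lead_of_poly p (not_dvd_of_natDegree_lt p (ne_zero_of_unit hu) hf) hu).2.symm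
  | zero => rw [map_zero, map_zero]; exact (map_zero (quotMk p)).symm
  | one => rw [map_one, map_one]; exact (map_one (quotMk p)).symm
  | add x y h1 h2 hx hy =>
    rw [map_add, map_add, hx, hy]
    exact (map_add (quotMk p) ⟨x, h1⟩ ⟨y, h2⟩).symm
  | neg x h1 hx =>
    rw [map_neg, map_neg, hx]
    exact (map_neg (quotMk p) ⟨x, h1⟩).symm
  | mul x y h1 h2 hx hy =>
    rw [map_mul, map_mul, hx, hy]
    exact (map_mul (quotMk p) ⟨x, h1⟩ ⟨y, h2⟩).symm

/-- If an element of the subring specializes to zero at `p`, then its product with `[p]` is in the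
subring. -/
theorem sym_primeUnit_mul_mem {x : KMW (RatFunc F)} (hx : x ∈ polySubring F p.1.natDegree)
    (h : specialization (datum p) x = 0) :
    sym (primeUnit p) * x ∈ polySubring F p.1.natDegree := by
  have h1 := fromResidueField_specialization p hx
  rw [h, map_zero, ← map_zero (quotMk p)] at h1
  simpa using (quotMk_eq_iff p).mp h1.symm

theorem ord_primeUnit {q : MonicIrreducible F} (h : q ≠ p) : (datum q).ord (primeUnit p) = 0 :=
  (ord_lead_of_poly q (f := p.1) (fun hd => h (Subtype.ext (Polynomial.eq_of_monic_of_associated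
    q.2.1 p.2.1 (q.2.2.associated_of_dvd p.2.2 hd)))) rfl).1

/-- In the derivation rule the second term drops out, since `x` is unramified at `p`, and `[p]` has
residue `1`. -/
theorem residue_primeUnit_mul {x : KMW (RatFunc F)} (hx : x ∈ polySubring F p.1.natDegree) :
    KMW.residue (datum p) (sym (primeUnit p) * x) = specialization (datum p) x := by
  rw [residue_mul_eq, residue_sym_unif _ _ rfl, residue_eq_zero_of_mem p le_rfl hx, one_mul,
    mul_zero, add_zero]

/-- Both factors are unramified at such `q`. So, apart from `p`, the product can ramify only at
primes of degree less than that of `p`; this drives the induction for surjectivity. -/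
theorem residue_primeUnit_mul_of_ne {q : MonicIrreducible F} (h : q ≠ p)
    (hd : p.1.natDegree ≤ q.1.natDegree)
    {x : KMW (RatFunc F)} (hx : x ∈ polySubring F p.1.natDegree) :
    KMW.residue (datum q) (sym (primeUnit p) * x) = 0 := by
  rw [residue_mul_eq, residue_sym_of_ord_eq_zero _ _ (ord_primeUnit p h),
    residue_eq_zero_of_mem q hd hx, zero_mul, mul_zero, add_zero]

/-- Homogeneous elements of the residue field lift to homogeneous elements of the subring. -/
theorem exists_specialization_eq {n : ℤ} {y : KMW (ResidueField p)}
    (hy : y ∈ deg (ResidueField p) n) : ∃ x ∈ polySubring F p.1.natDegree,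
      x ∈ deg (RatFunc F) n ∧ specialization (datum p) x = y := by
  refine gen_induction (P := fun n y => ∃ x ∈ polySubring F p.1.natDegree,
    x ∈ degGroup (RatFunc F) n ∧ specialization (datum p) x = y) ?_ ?_ ?_ ?_ ?_ ?_ (mem_deg.mp hy)
  · exact ⟨1, Subring.one_mem _, KMW.one_mem, map_one _⟩
  · rintro n a y ⟨x, h1, h2, rfl⟩
    refine ⟨sym (reducedUnit p a) * x, Subring.mul_mem _ (sym_reducedUnit_mem p a) h1,
      KMW.mul_mem (sym_mem _) h2, ?_⟩
    rw [map_mul, specialization_sym]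
    congr 2
    ext
    rw [(ord_lead_of_poly p (not_dvd_of_natDegree_lt p (ne_zero_of_unit (reducedUnit_eq p a))
      (natDegree_reducedPoly p a)) (reducedUnit_eq p a)).2, mk_reducedPoly]
  · rintro n y ⟨x, h1, h2, rfl⟩
    exact ⟨KMW.eta * x, Subring.mul_mem _ eta_mem_polySubring h1, KMW.mul_mem eta_mem h2,
      by rw [map_mul, specialization_eta]⟩
  · exact ⟨0, Subring.zero_mem _, AddSubgroup.zero_mem _, map_zero _⟩
  · rintro _ _ ⟨x, h1, h2, rfl⟩ ⟨y, h3, h4, rfl⟩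
    exact ⟨x + y, Subring.add_mem _ h1 h3, AddSubgroup.add_mem _ h2 h4, map_add _ _ _⟩
  · rintro _ ⟨x, h1, h2, rfl⟩
    exact ⟨-x, Subring.neg_mem _ h1, AddSubgroup.neg_mem _ h2, map_neg _ _⟩

end kernel
end MW

namespace MW
open Polynomial KMW

/-! ### One step of the filtration, and exactness for untwisted K-theory. -/

section step

variable {F : Type*} [Field F] {d : ℕ}

variable (F d) in
/-- The group generated by `polySubring F d` and its products with the symbols of the monic
irreducible polynomials of degree `d`. -/
noncomputable def primeSpan : AddSubgroup (KMW (RatFunc F)) :=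
  AddSubgroup.closure (polySubring F d ∪ {x | ∃ (p : MonicIrreducible F) (z : KMW (RatFunc F)),
    p.1.natDegree = d ∧ z ∈ polySubring F d ∧ sym (primeUnit p) * z = x})

theorem mem_primeSpan_of_mem {x : KMW (RatFunc F)} (hx : x ∈ polySubring F d) :
    x ∈ primeSpan F d := AddSubgroup.subset_closure (Or.inl hx)

theorem sym_mul_mem_primeSpan (p : MonicIrreducible F) (hp : p.1.natDegree = d)
    {z : KMW (RatFunc F)} (hz : z ∈ polySubring F d) : sym (primeUnit p) * z ∈ primeSpan F d :=
  AddSubgroup.subset_closure (Or.inr ⟨p, z, hp, hz, rfl⟩)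

theorem primeSpan_mul_mem {t x : KMW (RatFunc F)} (ht : t ∈ primeSpan F d)
    (hx : x ∈ polySubring F d) : t * x ∈ primeSpan F d := by
  induction ht using AddSubgroup.closure_induction with
  | mem t ht =>
    obtain ht | ⟨p, z, hp, hz, rfl⟩ := ht
    · exact mem_primeSpan_of_mem (Subring.mul_mem _ ht hx)
    · rw [mul_assoc]
      exact sym_mul_mem_primeSpan p hp (Subring.mul_mem _ hz hx)
  | zero => rw [zero_mul]; exact AddSubgroup.zero_mem _
  | add s t _ _ hs ht => rw [add_mul]; exact AddSubgroup.add_mem _ hs ht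
  | neg t _ ht => rw [neg_mul]; exact AddSubgroup.neg_mem _ ht

theorem mul_sym_mem_primeSpan (p : MonicIrreducible F) (hp : p.1.natDegree = d)
    {z : KMW (RatFunc F)} (hz : z ∈ polySubring F d) : z * sym (primeUnit p) ∈ primeSpan F d := by
  obtain ⟨y, hy, e⟩ := exists_mul_sym_eq (hp ▸ natDegree_pos p) (primeUnit p) hz
  rw [e]
  exact sym_mul_mem_primeSpan p hp hy

/-- The crucial reduction: two symbols of primes of degree `d` collapse to one. For `p = q` this is
`[p][p] = [p][-1]`. Otherwise `g = p - q` has smaller degree, and the Steinberg relation for `p/g -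
q/g = 1` rewrites the product. -/
theorem sym_mul_sym_mem_primeSpan (p q : MonicIrreducible F) (hp : p.1.natDegree = d)
    (hq : q.1.natDegree = d) : sym (primeUnit p) * sym (primeUnit q) ∈ primeSpan F d := by
  have hd : 0 < d := hp ▸ natDegree_pos p
  by_cases hpq : p = q
  · rw [hpq, sym_mul_self]
    exact sym_mul_mem_primeSpan q hq (sym_neg_one_mem_polySubring hd)
  have hg : p.1 - q.1 ≠ 0 := fun h => hpq (Subtype.ext (sub_eq_zero.mp h))
  -- Both polynomials are monic of degree `d`, so the leading terms cancel.
  have hgd : (p.1 - q.1).natDegree < d := by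
    have hdeg : p.1.degree = q.1.degree := by
      rw [Polynomial.degree_eq_natDegree p.2.2.ne_zero,
        Polynomial.degree_eq_natDegree q.2.2.ne_zero, hp, hq]
    have := Polynomial.degree_sub_lt_left hdeg p.2.2.ne_zero
      (by rw [p.2.1.leadingCoeff, q.2.1.leadingCoeff])
    rw [← hp]
    exact Polynomial.natDegree_lt_natDegree hg this
  have hgK : algebraMap F[X] (RatFunc F) (p.1 - q.1) ≠ 0 := fun h =>
    hg ((IsFractionRing.injective F[X] (RatFunc F)) (h.trans (map_zero _).symm))
  set g : (RatFunc F)ˣ := Units.mk0 _ hgK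
  have ha : sym g⁻¹ ∈ polySubring F d :=
    sym_inv_mem_polySubring (sym_mem_polySubring g _ hgd rfl)
  have hb : sym (-g⁻¹) ∈ polySubring F d := by
    rw [← neg_one_mul]
    exact sym_mul_mem_polySubring (sym_neg_one_mem_polySubring hd) ha
  set a := g⁻¹
  set b := -g⁻¹
  have st : sym (a * primeUnit p) * sym (b * primeUnit q) = 0 := by
    refine steinberg ?_
    simp only [a, b, Units.val_mul, Units.val_neg, Units.val_inv_eq_inv_val]
    have : (g : RatFunc F) = primeUnit p - primeUnit q := map_sub _ _ _
    have hg0 := g.ne_zero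
    field_simp
    linear_combination -this
  -- Expand `([a] + ⟨a⟩[p])([b] + ⟨b⟩[q]) = 0` and multiply by `⟨a⟩⟨b⟩`, which turns the coefficient
  -- of `[p][q]` into `1`.
  have key : sym (primeUnit p) * sym (primeUnit q) =
      -(form a * form b * (sym a * sym b) + form a * sym a * sym (primeUnit q) +
        sym (primeUnit p) * (form b * sym b)) := by
    have c1 : ∀ x y : KMW (RatFunc F), x * (form b * y) = form b * (x * y) := fun x y => by
      rw [← mul_assoc, ← (form_comm b x).eq, mul_assoc]
    rw [sym_mul', sym_mul', add_mul, mul_add, mul_add] at st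
    simp only [mul_assoc, c1] at st
    have := congrArg (fun z => form a * (form b * z)) st
    simp only [mul_add, mul_zero, form_mul_form_mul, c1] at this
    simp only [mul_assoc, c1]
    refine eq_neg_of_add_eq_zero_left (Eq.trans ?_ this)
    abel
  rw [key]
  have hfa := form_mem_polySubring ha
  have hfb := form_mem_polySubring hb
  exact AddSubgroup.neg_mem _ (AddSubgroup.add_mem _ (AddSubgroup.add_mem _
    (mem_primeSpan_of_mem (Subring.mul_mem _ (Subring.mul_mem _ hfa hfb) (Subring.mul_mem _ ha hb)))
    (mul_sym_mem_primeSpan q hq (Subring.mul_mem _ hfa ha)))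
    (sym_mul_mem_primeSpan p hp (Subring.mul_mem _ hfb hb)))

/-- For a generator `[q]z`, moving `[p]` to the left past `z` leaves `[q][p]` times an element of
the subring. -/
theorem primeSpan_mul_sym_mem {t : KMW (RatFunc F)} (ht : t ∈ primeSpan F d)
    (p : MonicIrreducible F) (hp : p.1.natDegree = d) :
    t * sym (primeUnit p) ∈ primeSpan F d := by
  induction ht using AddSubgroup.closure_induction with
  | mem t ht =>
    obtain ht | ⟨q, z, hq, hz, rfl⟩ := ht
    · exact mul_sym_mem_primeSpan p hp ht
    · obtain ⟨y, hy, e⟩ := exists_mul_sym_eq (hp ▸ natDegree_pos p) (primeUnit p) hz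
      rw [mul_assoc, e, ← mul_assoc]
      exact primeSpan_mul_mem (sym_mul_sym_mem_primeSpan q p hq hp) hy
  | zero => rw [zero_mul]; exact AddSubgroup.zero_mem _
  | add s t _ _ hs ht => rw [add_mul]; exact AddSubgroup.add_mem _ hs ht
  | neg t _ ht => rw [neg_mul]; exact AddSubgroup.neg_mem _ ht

/-- A polynomial of degree `d` is either a constant times a monic irreducible one or a product of
two polynomials of smaller degree; in each case `[xy] = [x] + ⟨x⟩[y]` reduces to symbols already
treated. -/
theorem primeSpan_mul_sym_poly_mem (hd : 0 < d) {t : KMW (RatFunc F)} (ht : t ∈ primeSpan F d)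
    {u : (RatFunc F)ˣ} {f : F[X]} (hu : (u : RatFunc F) = algebraMap F[X] (RatFunc F) f)
    (hf : f.natDegree < d + 1) : t * sym u ∈ primeSpan F d := by
  have hf0 : f ≠ 0 := ne_zero_of_unit hu
  have hK : ∀ {g : F[X]}, g ≠ 0 → algebraMap F[X] (RatFunc F) g ≠ 0 := fun hg h =>
    hg ((IsFractionRing.injective F[X] (RatFunc F)) (h.trans (map_zero _).symm))
  rcases Nat.lt_succ_iff_lt_or_eq.mp hf with hlt | heq
  · exact primeSpan_mul_mem ht (sym_mem_polySubring u f hlt hu)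
  by_cases hirr : Irreducible f
  · have hc : f.leadingCoeff ≠ 0 := Polynomial.leadingCoeff_ne_zero.mpr hf0
    have hC : (C f.leadingCoeff : F[X]) ≠ 0 := Polynomial.C_ne_zero.mpr hc
    have hCi : (C f.leadingCoeff⁻¹ : F[X]) ≠ 0 := Polynomial.C_ne_zero.mpr (inv_ne_zero hc)
    let p : MonicIrreducible F := ⟨f * C f.leadingCoeff⁻¹, Polynomial.monic_mul_leadingCoeff_inv hf0,
      (irreducible_mul_isUnit (Polynomial.isUnit_C.mpr (inv_ne_zero hc).isUnit)).mpr hirr⟩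
    have hp : p.1.natDegree = d := by
      rw [← heq]
      exact Polynomial.natDegree_mul_C (inv_ne_zero hc)
    have hcL : sym (Units.mk0 _ (hK hC)) ∈ polySubring F d :=
      sym_mem_polySubring _ (C f.leadingCoeff) (by simpa using hd) rfl
    have e : u = Units.mk0 _ (hK hC) * primeUnit p := by
      ext
      rw [Units.val_mul, hu]
      change _ = algebraMap F[X] (RatFunc F) _ * algebraMap F[X] (RatFunc F) _
      rw [← map_mul, mul_left_comm, ← C_mul, mul_inv_cancel₀ hc, C_1, mul_one]
    rw [e, sym_mul', mul_add, ← mul_assoc]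
    exact AddSubgroup.add_mem _ (primeSpan_mul_mem ht hcL)
      (primeSpan_mul_sym_mem (primeSpan_mul_mem ht (form_mem_polySubring hcL)) p hp)
  -- Neither factor is a unit, so both have positive degree, and the degrees add up to `d`.
  · obtain ⟨g, h, hg, hh, rfl⟩ : ∃ g h : F[X], g.natDegree < d ∧ h.natDegree < d ∧ g * h = f := by
      rw [irreducible_iff] at hirr
      push Not at hirr
      obtain ⟨g, h, rfl, hg, hh⟩ := hirr
        (Polynomial.not_isUnit_of_natDegree_pos _ (by omega))
      have hg0 := left_ne_zero_of_mul hf0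
      have hh0 := right_ne_zero_of_mul hf0
      rw [Polynomial.natDegree_mul hg0 hh0] at heq
      have h1 : g.natDegree ≠ 0 := fun h0 => hg
        (Polynomial.isUnit_iff_degree_eq_zero.mpr
          (by rw [Polynomial.degree_eq_natDegree hg0, h0]; rfl))
      have h2 : h.natDegree ≠ 0 := fun h0 => hh
        (Polynomial.isUnit_iff_degree_eq_zero.mpr
          (by rw [Polynomial.degree_eq_natDegree hh0, h0]; rfl))
      exact ⟨g, h, by omega, by omega, rfl⟩
    have e : u = Units.mk0 _ (hK (left_ne_zero_of_mul hf0)) *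
        Units.mk0 _ (hK (right_ne_zero_of_mul hf0)) := by
      ext
      rw [Units.val_mul, hu, map_mul]
      rfl
    rw [e]
    exact primeSpan_mul_mem ht (sym_mul_mem_polySubring (sym_mem_polySubring _ g hg rfl)
      (sym_mem_polySubring _ h hh rfl))

theorem polySubring_succ_le (hd : 0 < d) {x : KMW (RatFunc F)} (hx : x ∈ polySubring F (d + 1)) :
    x ∈ primeSpan F d := by
  -- Stability under right multiplication, unlike membership itself, passes to products of
  -- generators; applied to `t = 1` it gives membership.
  suffices h : ∀ t ∈ primeSpan F d, t * x ∈ primeSpan F d by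
    simpa using h 1 (mem_primeSpan_of_mem (Subring.one_mem _))
  induction hx using Subring.closure_induction with
  | mem x hx =>
    intro t ht
    obtain rfl | ⟨u, f, hf, hu, rfl⟩ := hx
    · exact primeSpan_mul_mem ht eta_mem_polySubring
    · exact primeSpan_mul_sym_poly_mem hd ht hu hf
  | zero => intro t _; rw [mul_zero]; exact AddSubgroup.zero_mem _
  | one => intro t ht; rwa [mul_one]
  | add x y _ _ hx hy =>
    intro t ht
    rw [mul_add]
    exact AddSubgroup.add_mem _ (hx t ht) (hy t ht)
  | neg x _ hx =>
    intro t ht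
    rw [mul_neg]
    exact AddSubgroup.neg_mem _ (hx t ht)
  | mul x y _ _ hx hy =>
    intro t ht
    rw [← mul_assoc]
    exact hy _ (hx t ht)

/-- Collecting the terms leaves one coefficient for each prime, so that a residue at `p` sees only
the coefficient at `p`. -/
theorem exists_finsupp_of_mem_primeSpan {x : KMW (RatFunc F)} (hx : x ∈ primeSpan F d) :
    ∃ y ∈ polySubring F d, ∃ c : MonicIrreducible F →₀ KMW (RatFunc F),
      (∀ p ∈ c.support, p.1.natDegree = d) ∧ (∀ p, c p ∈ polySubring F d) ∧
      x = y + c.sum fun p z => sym (primeUnit p) * z := by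
  classical
  induction hx using AddSubgroup.closure_induction with
  | mem x hx =>
    obtain hx | ⟨p, z, hp, hz, rfl⟩ := hx
    · exact ⟨x, hx, 0, by simp, by simp, by simp⟩
    · refine ⟨0, Subring.zero_mem _, Finsupp.single p z, fun q hq => ?_, fun q => ?_, ?_⟩
      · rw [Finset.mem_singleton.mp (Finsupp.support_single_subset hq), hp]
      · rw [Finsupp.single_apply]
        split_ifs
        · exact hz
        · exact Subring.zero_mem _
      · rw [Finsupp.sum_single_index (mul_zero _), zero_add]
  | zero => exact ⟨0, Subring.zero_mem _, 0, by simp, by simp, by simp⟩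
  | add x x' _ _ hx hx' =>
    obtain ⟨y, hy, c, h1, h2, rfl⟩ := hx
    obtain ⟨y', hy', c', h1', h2', rfl⟩ := hx'
    refine ⟨y + y', Subring.add_mem _ hy hy', c + c', fun q hq => ?_,
      fun q => Subring.add_mem _ (h2 q) (h2' q), ?_⟩
    · exact (Finset.mem_union.mp (Finsupp.support_add hq)).elim (h1 q) (h1' q)
    · rw [Finsupp.sum_add_index' (fun _ => mul_zero _) (fun _ _ _ => mul_add _ _ _)]
      abel
  | neg x _ hx =>
    obtain ⟨y, hy, c, h1, h2, rfl⟩ := hx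
    refine ⟨-y, Subring.neg_mem _ hy, -c, fun q hq => h1 q (by rwa [Finsupp.support_neg] at hq),
      fun q => Subring.neg_mem _ (h2 q), ?_⟩
    rw [Finsupp.sum_neg_index (fun _ => mul_zero _), neg_add]
    simp [Finsupp.sum]

/-- Write `x` as `y` plus the sum of the `[p] z_p`. The residue at `p` is the specialization of
`z_p`; as it vanishes, `[p] z_p` lies in `polySubring F d`, and so does every summand. -/
theorem mem_polySubring_of_residue_eq_zero (hd : 0 < d) {x : KMW (RatFunc F)}
    (hx : x ∈ polySubring F (d + 1))
    (h : ∀ p : MonicIrreducible F, p.1.natDegree = d → KMW.residue (datum p) x = 0) :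
    x ∈ polySubring F d := by
  obtain ⟨y, hy, c, h1, h2, rfl⟩ := exists_finsupp_of_mem_primeSpan (polySubring_succ_le hd hx)
  refine Subring.add_mem _ hy (Subring.sum_mem _ fun p hp => ?_)
  have hpd := h1 p hp
  have h3 := h p hpd
  rw [map_add, residue_eq_zero_of_mem p hpd.ge hy, zero_add, Finsupp.sum, map_sum,
    Finset.sum_eq_single p, residue_primeUnit_mul p (hpd ▸ h2 p)] at h3
  · have := sym_primeUnit_mul_mem p (hpd ▸ h2 p) h3
    rwa [hpd] at this
  · intro q hq hne
    have hqd := h1 q hq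
    exact residue_primeUnit_mul_of_ne q hne.symm (by rw [hqd, hpd]) (hqd ▸ h2 q)
  · exact fun hn => absurd hp hn

/-- An element of the Milnor-Witt K-theory of `F(t)` all of whose residues vanish comes from `F`. -/
theorem exists_map_eq_of_residue_eq_zero {x : KMW (RatFunc F)}
    (h : ∀ p : MonicIrreducible F, KMW.residue (datum p) x = 0) :
    ∃ y : KMW F, KMW.map (algebraMap F (RatFunc F)) y = x := by
  -- Descent one degree at a time. It stops at index `1`, below which there are no primes left.
  have key : ∀ d, x ∈ polySubring F (d + 1) → x ∈ polySubring F 1 := by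
    intro d
    induction d with
    | zero => exact id
    | succ d ih => exact fun hx => ih (mem_polySubring_of_residue_eq_zero d.succ_pos hx fun p _ => h p)
  obtain ⟨d, hd⟩ := exists_mem_polySubring x
  exact mem_polySubring_one (key d (polySubring_mono d.le_succ hd))

/-- Constants lie in `polySubring F 1`, which is unramified everywhere because every prime has
degree at least `1`. -/
theorem residue_map (p : MonicIrreducible F) (y : KMW F) :
    KMW.residue (datum p) (KMW.map (algebraMap F (RatFunc F)) y) = 0 := by
  refine residue_eq_zero_of_mem p (natDegree_pos p) (d := 1) ?_
  induction y using KMW.induction with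
  | hz n => rw [map_intCast]; exact intCast_mem _ n
  | hs a =>
    rw [map_sym]
    exact sym_mem_polySubring _ (C (a : F)) (by simp) rfl
  | he => rw [map_eta]; exact eta_mem_polySubring
  | hadd x y hx hy => rw [map_add]; exact Subring.add_mem _ hx hy
  | hmul x y hx hy => rw [map_mul]; exact Subring.mul_mem _ hx hy

/-- Every homogeneous element at `p` is the residue at `p` of a homogeneous element that is
unramified at all other places. -/
theorem exists_residue_eq {n : ℤ} (p : MonicIrreducible F) {y : KMW (ResidueField p)}
    (hy : y ∈ deg (ResidueField p) (n - 1)) : ∃ z ∈ deg (RatFunc F) n,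
      KMW.residue (datum p) z = y ∧ ∀ q ≠ p, KMW.residue (datum q) z = 0 := by
  classical
  induction hN : p.1.natDegree using Nat.strong_induction_on generalizing p with
  | _ N ih =>
  subst hN
  obtain ⟨x, h1, h2, rfl⟩ := exists_specialization_eq p hy
  have hz : sym (primeUnit p) * x ∈ deg (RatFunc F) n := by
    have := KMW.mul_mem (sym_mem (primeUnit p)) (mem_deg.mp h2)
    rwa [add_sub_cancel] at this
  set z := sym (primeUnit p) * x
  set S := (finite_residue_ne_zero z).toFinset.erase p
  -- A prime `q ≠ p` at which `z` ramifies has smaller degree than `p`, so the induction hypothesis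
  -- provides an element with the residue of `z` at `q` and no other residue.
  have hS : ∀ q ∈ S, ∃ w ∈ deg (RatFunc F) n, KMW.residue (datum q) w = KMW.residue (datum q) z ∧
      ∀ q' ≠ q, KMW.residue (datum q') w = 0 := by
    intro q hq
    rw [Finset.mem_erase, Set.Finite.mem_toFinset] at hq
    refine ih _ ?_ q (residue_mem _ hz) rfl
    by_contra hlt
    exact hq.2 (residue_primeUnit_mul_of_ne p hq.1 (not_lt.mp hlt) h1)
  choose! w hw1 hw2 hw3 using hS
  -- The corrections cancel the residues of `z` away from `p` and do not change the one at `p`.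
  refine ⟨z - ∑ q ∈ S, w q, sub_mem hz (sum_mem hw1), ?_, fun q hq => ?_⟩
  · rw [map_sub, map_sum, Finset.sum_eq_zero, sub_zero]
    · exact residue_primeUnit_mul p h1
    · exact fun q hq => hw3 q hq p (Finset.ne_of_mem_erase hq).symm
  · rw [map_sub, map_sum, sub_eq_zero]
    by_cases hqS : q ∈ S
    · rw [Finset.sum_eq_single q (fun q' hq' hne => hw3 q' hq' q hne.symm)
        (fun hn => absurd hqS hn), hw2 q hqS]
    · rw [Finset.sum_eq_zero fun q' hq' => hw3 q' hq' q (fun h => hqS (h ▸ hq'))]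
      by_contra hne
      exact hqS (Finset.mem_erase.mpr ⟨hq, (Set.Finite.mem_toFinset _).mpr hne⟩)

end step

/-! ### Specialization at the origin. -/

section retraction

variable (F : Type*) [Field F]

/-- The place `t = 0` of `F(t)`. -/
noncomputable def originPrime : MonicIrreducible F := ⟨X, monic_X, irreducible_X⟩

/-- The isomorphism `F[t] / (t) → F`. -/
noncomputable def originEval : ResidueField (originPrime F) →+* F :=
  Ideal.Quotient.lift _ (evalRingHom 0) (fun a ha => by
    obtain ⟨b, rfl⟩ := Ideal.mem_span_singleton.mp ha
    simp [originPrime])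

/-- Specialization at `t = 0`, a retraction of the inclusion of the Milnor-Witt K-theory of `F`. -/
noncomputable def evalZero : KMW (RatFunc F) →+* KMW F :=
  (KMW.map (originEval F)).comp (specialization (datum (originPrime F)))

variable {F}

/-- Both ring homomorphisms fix `η` and the symbols: a nonzero constant is a unit at `t = 0` and
reduces to itself. -/
theorem evalZero_map (x : KMW F) : evalZero F (KMW.map (algebraMap F (RatFunc F)) x) = x := by
  refine ringHom_ext (f := (evalZero F).comp (KMW.map (algebraMap F (RatFunc F))))
    (g := RingHom.id _) (fun a => ?_) ?_ x
  · change KMW.map _ (specialization _ (KMW.map _ (sym a))) = sym a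
    rw [map_sym, specialization_sym, map_sym]
    congr 1
    ext
    have hdvd : ¬ (originPrime F).1 ∣ C (a : F) := not_dvd_of_natDegree_lt _ (by simp)
      (by simpa using natDegree_pos (originPrime F))
    have h := (ord_lead_of_poly (originPrime F) (u := Units.map (algebraMap F (RatFunc F)) a)
      hdvd rfl).2
    change originEval F ((datum (originPrime F)).lead _ : ResidueField (originPrime F)) = a
    rw [h]
    simp [originEval]
  · change KMW.map _ (specialization _ (KMW.map _ KMW.eta)) = KMW.eta
    rw [map_eta, specialization_eta, map_eta]

theorem evalZero_mem {n : ℤ} {x : KMW (RatFunc F)} (hx : x ∈ deg (RatFunc F) n) :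
    evalZero F x ∈ deg F n := map_mem _ (specialization_mem _ hx)

end retraction
end MW

namespace MW
open TensorProduct KaehlerDifferential Polynomial KMW

/-! ### Splittings and maps to direct sums. -/

/-- A retraction of the first map of a short exact sequence splits the sequence. -/
theorem exists_splitting {A B C : Type*} [AddCommGroup A] [AddCommGroup B] [AddCommGroup C]
    {i : A →+ B} {d : B →+ C} {r : B →+ A} (hex : Function.Exact i d)
    (hd : Function.Surjective d) (hr : ∀ a, r (i a) = a) :
    ∃ s : C →+ B, d.comp s = AddMonoidHom.id C ∧ i.comp r + s.comp d = AddMonoidHom.id B := by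
  -- A set-theoretic lift, corrected so that `r` vanishes on it; additivity is not yet visible.
  set g : C → B := fun c => Function.surjInv hd c - i (r (Function.surjInv hd c))
  have hdg : ∀ c, d (g c) = c := fun c => by
    rw [map_sub, hex.apply_apply_eq_zero, sub_zero, Function.surjInv_eq hd]
  have hrg : ∀ c, r (g c) = 0 := fun c => by rw [map_sub, hr, sub_self]
  -- An element of `B` is determined by its images under `d` and `r`. This yields the additivity of
  -- `g` as well as the last identity.
  have huniq : ∀ x y : B, d x = d y → r x = r y → x = y := fun x y h1 h2 => by
    obtain ⟨a, ha⟩ := (hex (x - y)).mp (by rw [map_sub, h1, sub_self])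
    have h3 := hr a
    rw [ha, map_sub, h2, sub_self] at h3
    rw [← h3, map_zero] at ha
    exact sub_eq_zero.mp ha.symm
  refine ⟨AddMonoidHom.mk' g fun c c' => huniq _ _ ?_ ?_, ?_, ?_⟩
  · rw [map_add, hdg, hdg, hdg]
  · rw [map_add, hrg, hrg, hrg, add_zero]
  · ext c
    exact hdg c
  · ext x
    refine huniq _ _ ?_ ?_
    · change d (i (r x) + g (d x)) = d x
      rw [map_add, hdg, hex.apply_apply_eq_zero, zero_add]
    · change r (i (r x) + g (d x)) = r x
      rw [map_add, hrg, hr, add_zero]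

section directSum

variable {ι A : Type*} {B : ι → Type*} [AddCommGroup A] [∀ i, AddCommGroup (B i)]
  {f : ∀ i, A →+ B i} {hf : ∀ x, {i | f i x ≠ 0}.Finite}

theorem toDirectSum_eq_zero_iff {x : A} : toDirectSum f hf x = 0 ↔ ∀ i, f i x = 0 := by
  refine ⟨fun h i => ?_, fun h => DFinsupp.ext fun i => (toDirectSum_apply f hf x i).trans (h i)⟩
  rw [← toDirectSum_apply f hf, h, DirectSum.zero_apply]

theorem toDirectSum_surjective (h : ∀ i (y : B i), ∃ x, f i x = y ∧ ∀ j ≠ i, f j x = 0) :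
    Function.Surjective (toDirectSum f hf) := by
  classical
  intro y
  induction y using DirectSum.induction_on with
  | zero => exact ⟨0, map_zero _⟩
  | add x y hx hy =>
    obtain ⟨a, rfl⟩ := hx
    obtain ⟨b, rfl⟩ := hy
    exact ⟨a + b, map_add _ _ _⟩
  | of i y =>
    obtain ⟨x, h1, h2⟩ := h i y
    refine ⟨x, DFinsupp.ext fun j => (toDirectSum_apply f hf x j).trans ?_⟩
    by_cases hj : j = i
    · subst hj
      exact h1.trans (DirectSum.of_eq_same j y).symm
    · exact (h2 j hj).trans (DirectSum.of_eq_of_ne i j y hj).symm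

end directSum

/-! ### Removing the twists. -/

section trivialization

variable {E L : Type*} [Field E] [AddCommGroup L] [Module E L]

/-- Every `l` is `c • m` for a unique unit `c`, and `α ⊗ l = ⟨c⟩α ⊗ m`; the inverse sends `α ⊗ l` to
`⟨c⟩α`. -/
theorem twHom_bijective (h : Module.finrank E L = 1) (m : NonzeroVec L) (n : ℤ) :
    Function.Bijective (twHom (F := E) (n := n) m) := by
  constructor
  · have hg : ∀ (u : Eˣ) (l : NonzeroVec L) (α : deg E n),
        formMulHom (ratio h m (u • l)) n α = formMulHom (ratio h m l) n (formMul u α) := by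
      intro u l α
      rw [ratio_units_smul]
      refine Subtype.ext ?_
      change form _ * α.1 = form _ * (form u * α.1)
      rw [mul_comm u, form_mul, mul_assoc]
    refine Function.LeftInverse.injective
      (g := twLift (fun l => formMulHom (ratio h m l) n) hg) fun α => ?_
    change twLift _ hg (tw α m) = α
    rw [twLift_tw, ratio_eq _ _ _ 1 (one_smul _ _)]
    exact Subtype.ext (by change form 1 * α.1 = α.1; rw [form_one, one_mul])
  · intro x
    induction x using twisted_induction with
    | h0 => exact ⟨0, map_zero _⟩
    | hadd x y hx hy =>
      obtain ⟨α, rfl⟩ := hx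
      obtain ⟨β, rfl⟩ := hy
      exact ⟨α + β, map_add _ _ _⟩
    | ht α l =>
      refine ⟨formMul (ratio h m l) α, ?_⟩
      change tw _ _ = _
      rw [tw_formMul, ratio_smul]

/-- The isomorphism `α ↦ α ⊗ m`, for a nonzero element `m` of a line. -/
noncomputable def twEquiv (h : Module.finrank E L = 1) (m : NonzeroVec L) (n : ℤ) :
    deg E n ≃+ Twisted E L n :=
  AddEquiv.ofBijective (twHom m) (twHom_bijective h m n)

end trivialization

variable (k : Type*) {F : Type*} [Field k] [Field F] [Algebra k F] [Algebra.EssFiniteType k F]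

variable (F) in
/-- The generator `e₁ ∧ ⋯ ∧ e_r` of `det Ω_{F/k}`. -/
noncomputable def baseGenerator : NonzeroVec (Det F Ω[F⁄k]) :=
  ⟨exteriorPower.ιMulti F _ (Module.finBasis F Ω[F⁄k]), fun h =>
    ιMulti_basis_ne_zero (Module.finBasis F Ω[F⁄k]) (congrArg Subtype.val h)⟩

/-- The basis of the differentials of `F(t)` ends with `dt`, so the chosen generators correspond
with no sign or unit between them. -/
theorem wedgeDtVec_baseGenerator : wedgeDtVec k F (baseGenerator k F) = genericGenerator k F :=
  Subtype.ext (Subtype.ext (extMap_mul_eq (Module.finBasis F Ω[F⁄k])))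

/-- Base change from `F` to `F(t)` in degree `n`. -/
noncomputable def baseChangeHom (n : ℤ) : deg F n →+ deg (RatFunc F) n where
  toFun α := ⟨KMW.map (algebraMap F (RatFunc F)) α.1, map_mem _ α.2⟩
  map_zero' := Subtype.ext (map_zero _)
  map_add' _ _ := Subtype.ext (map_add _ _ _)

/-- Specialization at `t = 0` in degree `n`. -/
noncomputable def evalZeroHom (n : ℤ) : deg (RatFunc F) n →+ deg F n where
  toFun α := ⟨evalZero F α.1, evalZero_mem α.2⟩
  map_zero' := Subtype.ext (map_zero _)
  map_add' _ _ := Subtype.ext (map_add _ _ _)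

variable (F) in
/-- `K^MW_n(F) ≅ K^MW_n(F, D(Ω_{F/k}))`. -/
noncomputable def baseEquiv (n : ℤ) : deg F n ≃+ Twisted F (Det F Ω[F⁄k]) n :=
  twEquiv (finrank_det F Ω[F⁄k]) (baseGenerator k F) n

variable (F) in
/-- `K^MW_n(F(t)) ≅ K^MW_n(F(t), D(Ω_{F(t)/k}))`. -/
noncomputable def genericEquiv (n : ℤ) :
    deg (RatFunc F) n ≃+ Twisted (RatFunc F) (Det (RatFunc F) Ω[RatFunc F⁄k]) n :=
  twEquiv (finrank_genericDet k) (genericGenerator k F) n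

theorem inclusion_baseEquiv (n : ℤ) (α : deg F n) :
    inclusion k F n (baseEquiv k F n α) = genericEquiv k F n (baseChangeHom n α) := by
  change inclusion k F n (tw α (baseGenerator k F)) = tw _ (genericGenerator k F)
  rw [inclusion, twLift_tw, wedgeDtVec_baseGenerator]
  rfl

variable (F) in
/-- The retraction of the inclusion given by specialization at `t = 0`. -/
noncomputable def retraction (n : ℤ) :
    Twisted (RatFunc F) (Det (RatFunc F) Ω[RatFunc F⁄k]) n →+ Twisted F (Det F Ω[F⁄k]) n :=
  (baseEquiv k F n).toAddMonoidHom.comp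
    ((evalZeroHom n).comp (genericEquiv k F n).symm.toAddMonoidHom)

theorem retraction_inclusion (n : ℤ) (x : Twisted F (Det F Ω[F⁄k]) n) :
    retraction k F n (inclusion k F n x) = x := by
  obtain ⟨α, rfl⟩ := (baseEquiv k F n).surjective x
  rw [inclusion_baseEquiv]
  change baseEquiv k F n (evalZeroHom n ((genericEquiv k F n).symm (genericEquiv k F n _))) = _
  rw [AddEquiv.symm_apply_apply]
  congr 1
  exact Subtype.ext (evalZero_map α.1)

variable [PerfectField k]

/-- `K^MW_n(F(p)) ≅ K^MW_n(F(p), D(Ω_{F(p)/k}))`. -/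
noncomputable def residueEquiv (p : MonicIrreducible F) (n : ℤ) :
    deg (ResidueField p) n ≃+
      Twisted (ResidueField p) (Det (ResidueField p) Ω[ResidueField p⁄k]) n :=
  twEquiv (have := finite_residueDifferentials k p; finrank_det _ _)
    -- This vector corresponds to `p̄^* ⊗ m̄` under the canonical isomorphism, sign included, so no
    -- form `⟨c⟩` appears when the twisted residue is compared with the untwisted one.
    ((targetGenerator k p).map (canonicalIso k p).symm) n

theorem residueAt_genericEquiv (p : MonicIrreducible F) (n : ℤ) (α : deg (RatFunc F) n) :
    residueAt k p n (genericEquiv k F n α) = residueEquiv k p (n - 1) (residueHom p n α) := by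
  change twCongr _ _ (twistedResidue k p n (tw α (genericGenerator k F))) = tw _ _
  rw [twistedResidue_tw, twCongr, twLift_tw]
  rfl

theorem residueAt_genericEquiv_eq_zero_iff (p : MonicIrreducible F) (n : ℤ)
    (α : deg (RatFunc F) n) :
    residueAt k p n (genericEquiv k F n α) = 0 ↔ KMW.residue (datum p) α.1 = 0 := by
  rw [residueAt_genericEquiv, AddEquiv.map_eq_zero_iff]
  exact Subtype.ext_iff

theorem exact_inclusion_totalResidue (n : ℤ) :
    Function.Exact (inclusion k F n) (totalResidue k F n) := by
  intro x
  obtain ⟨α, rfl⟩ := (genericEquiv k F n).surjective x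
  rw [totalResidue, toDirectSum_eq_zero_iff]
  simp only [residueAt_genericEquiv_eq_zero_iff]
  constructor
  · intro h
    obtain ⟨y, hy⟩ := exists_map_eq_of_residue_eq_zero h
    -- The preimage comes from the whole ring. It is homogeneous because specialization at `t = 0`
    -- recovers it from an element of degree `n`.
    have hmem : y ∈ deg F n := by
      rw [← evalZero_map y, hy]
      exact evalZero_mem α.2
    refine ⟨baseEquiv k F n ⟨y, hmem⟩, ?_⟩
    rw [inclusion_baseEquiv]
    congr 1
    exact Subtype.ext hy
  · rintro ⟨y, hy⟩ p
    obtain ⟨β, rfl⟩ := (baseEquiv k F n).surjective y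
    rw [inclusion_baseEquiv] at hy
    rw [← (genericEquiv k F n).injective hy]
    exact residue_map p β.1

theorem exists_residueAt_eq (p : MonicIrreducible F) (n : ℤ)
    (y : Twisted (ResidueField p) (Det (ResidueField p) Ω[ResidueField p⁄k]) (n - 1)) :
    ∃ x, residueAt k p n x = y ∧ ∀ q ≠ p, residueAt k q n x = 0 := by
  obtain ⟨β, rfl⟩ := (residueEquiv k p (n - 1)).surjective y
  obtain ⟨z, hz, h1, h2⟩ := exists_residue_eq p β.2
  have h3 : residueHom p n ⟨z, hz⟩ = β := Subtype.ext h1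
  refine ⟨genericEquiv k F n ⟨z, hz⟩, ?_, ?_⟩
  · rw [residueAt_genericEquiv, h3]
  · intro q hq
    rw [residueAt_genericEquiv_eq_zero_iff]
    exact h2 q hq

theorem totalResidue_surjective (n : ℤ) : Function.Surjective (totalResidue k F n) := by
  have h := toDirectSum_surjective (f := fun p : MonicIrreducible F => residueAt k p n)
    (hf := finite_residueAt_ne_zero k) (fun p => exists_residueAt_eq k p n)
  rw [totalResidue]
  with_reducible_and_instances exact h

end MW

/-- For a perfect field `k`, a finitely generated field extension `F` of `k` and every degree `n`,
the sequence `0 → K^MW_n(F, D(Ω_{F/k})) → K^MW_n(F(t), D(Ω_{F(t)/k})) →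
⨁_p K^MW_{n-1}(F(p), D(Ω_{F(p)/k})) → 0` is split exact. -/
theorem mainTheorem6 (k F : Type*) [Field k] [PerfectField k] [Field F] [Algebra k F]
    [Algebra.EssFiniteType k F] (n : ℤ) :
    Function.Injective (MW.inclusion k F n) ∧
    Function.Exact (MW.inclusion k F n) (MW.totalResidue k F n) ∧
    Function.Surjective (MW.totalResidue k F n) ∧
    ∃ (r : MW.KMW.Twisted (RatFunc F) (MW.Det (RatFunc F) (Ω[RatFunc F⁄k])) n →+
          MW.KMW.Twisted F (MW.Det F (Ω[F⁄k])) n)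
      (s : (DirectSum (MW.MonicIrreducible F) fun p =>
            MW.KMW.Twisted (MW.ResidueField p)
              (MW.Det (MW.ResidueField p) (Ω[MW.ResidueField p⁄k])) (n - 1)) →+
          MW.KMW.Twisted (RatFunc F) (MW.Det (RatFunc F) (Ω[RatFunc F⁄k])) n),
      r.comp (MW.inclusion k F n) = AddMonoidHom.id _ ∧
      (MW.totalResidue k F n).comp s = AddMonoidHom.id _ ∧
      (MW.inclusion k F n).comp r + s.comp (MW.totalResidue k F n) = AddMonoidHom.id _ := by
  have hex := MW.exact_inclusion_totalResidue k (F := F) n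
  have hsurj := MW.totalResidue_surjective k (F := F) n
  have hr := MW.retraction_inclusion k (F := F) n
  obtain ⟨s, hs1, hs2⟩ := MW.exists_splitting hex hsurj hr
  exact ⟨Function.LeftInverse.injective hr, hex, hsurj, MW.retraction k F n, s,
    AddMonoidHom.ext hr, hs1, hs2⟩
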